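/- Let $\mathrm{Ai},\mathrm{Bi}$ be the Airy functions and let $u$ be the Hastings–McLeod solution of Painlevé II, i.e. the real solution of $u''=tu+2u^3$ on $\mathbb R$ with $u(t)\sim\mathrm{Ai}(t)$ as $t\to+\infty$. Consider the linear system $$\phi_1'=-\tfrac23\phi_2,\qquad \phi_2'=-\tfrac23u\,\phi_0-\tfrac16(t+2u^2)\phi_1,\qquad \phi_0'=\tfrac13u'\phi_1-\tfrac23u\,\phi_2.\tag{1}$$ Put $g_1(t)=\mathrm{Bi}(t/3^{2/3})$, $g_2(t)=\mathrm{Ai}(t/3^{2/3})$, $g_0(t)=0$, $\delta_k=1$ if $k=0$ and $\delta_k=0$ if $k=1,2$. For a triple $(\phi_1,\phi_2,\phi_0)$ put $S[\phi]=-\tfrac23u\,\phi_0-\tfrac13u^2\phi_1$ and $$A[\phi](t)=\int_\infty^t\mathrm{Ai}(s/3^{2/3})\,S[\phi](s)\,ds,\qquad B[\phi](t)=\int_\infty^t\mathrm{Bi}(s/3^{2/3})\,S[\phi](s)\,ds.$$ For $k=1,2,0$ define the iterates by $\Phi_{1k}^{(0)}=(1-\delta_k)g_k$, $\Phi_{2k}^{(0)}=-\tfrac32(1-\delta_k)g_k'$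 and, for $j\ge0$, with $\Phi_{\cdot k}^{(j)}=(\Phi_{1k}^{(j)},\Phi_{2k}^{(j)},\Phi_{0k}^{(j)})$, $$\Phi_{1k}^{(j+1)}(t)=g_k(t)+\tfrac{2\pi}{3^{1/3}}\Big[\mathrm{Ai}(\tfrac t{3^{2/3}})\,B[\Phi_{\cdot k}^{(j)}](t)-\mathrm{Bi}(\tfrac t{3^{2/3}})\,A[\Phi_{\cdot k}^{(j)}](t)\Big],$$ $$\Phi_{2k}^{(j+1)}(t)=-\tfrac32g_k'(t)-\pi\Big[\mathrm{Ai}'(\tfrac t{3^{2/3}})\,B[\Phi_{\cdot k}^{(j)}](t)-\mathrm{Bi}'(\tfrac t{3^{2/3}})\,A[\Phi_{\cdot k}^{(j)}](t)\Big],$$ and, for all $j\ge0$, $$\Phi_{0k}^{(j)}(t)=\delta_k+\int_\infty^t\Big(\tfrac13u'(s)\Phi_{1k}^{(j)}(s)-\tfrac23u(s)\Phi_{2k}^{(j)}(s)\Big)ds .$$ Call $t_0^P\ge1$ a *threshold* if $$|\mathrm{Bi}(x)|<e^{\frac23x^{3/2}},\quad|\mathrm{Bi}'(x)|<\sqrt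 x\,e^{\frac23x^{3/2}},\quad|\mathrm{Ai}(x)|<e^{-\frac23x^{3/2}},\quad|\mathrm{Ai}'(x)|<\sqrt x\,e^{-\frac23x^{3/2}}\qquad(x\ge t_0^P/3^{2/3}),$$ $$|u(x)|<e^{-\frac23x^{3/2}},\quad|u'(x)|<\sqrt x\,e^{-\frac23x^{3/2}}\qquad(x\ge t_0^P).$$ **Theorem.** Thresholds exist, and for every threshold $t_0^P$ the following holds. 1. All integrals in the definition of the iterates converge absolutely for $t\ge t_0^P$. 2. For $k=1,2,0$, $j\ge0$ and $t\ge t_0^P$, $$|\Phi_{1k}^{(j+1)}-\Phi_{1k}^{(j)}|(t)<C_{1k}^{(j+1)}e^{-(\frac43j+\frac49k+\frac23)t^{3/2}},\qquad|\Phi_{2k}^{(j+1)}-\Phi_{2k}^{(j)}|(t)<C_{2k}^{(j+1)}t^{1/2}e^{-(\frac43j+\frac49k+\frac23)t^{3/2}},$$ $$|\Phi_{0k}^{(j+1)}-\Phi_{0k}^{(j)}|(t)<C_{0k}^{(j+1)}e^{-(\frac43j+\frac49k+\frac43)t^{3/2}},$$ where, for $j\ge1$, $C_{2k}^{(j)}=\frac12C_{1k}^{(j)}$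 and $$C_{11}^{(j)}=\pi^j3^{-j/3}\prod_{i=1}^j\tfrac{6i-1}{(3i-1)(3i-2)},\qquad C_{01}^{(j)}=\pi^j3^{-j/3}\prod_{i=1}^j\tfrac{6i-1}{(3i-1)(3i+1)},$$ $$C_{12}^{(j)}=\pi^j3^{-j/3}\prod_{i=1}^j\tfrac{6i+1}{3i(3i-1)},\qquad C_{02}^{(j)}=\tfrac12\pi^j3^{-j/3}\prod_{i=1}^j\tfrac{6i+1}{3i(3i+2)},$$ $$C_{10}^{(j)}=\tfrac{3\pi^j3^{-j/3}}{(j-1)!}\prod_{i=1}^j\tfrac{2i-1}{3i-2},\qquad C_{00}^{(j)}=\tfrac{\pi^j3^{-j/3}}{j!}\prod_{i=1}^j\tfrac{2i-1}{3i-2}.$$ 3. For $k=1,2,0$ and every $t\ge t_0^P$, the limits $\Phi_{ik}(t)=\lim_{j\to\infty}\Phi_{ik}^{(j)}(t)$, $i=1,2,0$, exist. On $[t_0^P,\infty)$ each triple $(\Phi_{1k},\Phi_{2k},\Phi_{0k})$ solves the integral equations obtained by dropping the superscripts $(j)$, $(j+1)$ in the recursion (with absolutely convergent integrals) and solves the linear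 system (1). The three triples are linearly independent on $[t_0^P,\infty)$. -/

import Mathlib

open MeasureTheory Filter Topology

namespace AiryPicard

noncomputable section

/-- The Airy function `Ai` on the real line, as the absolutely convergent contour integral
`(2πi)⁻¹ ∫ exp (z³/3 - x z) dz` from `∞ e^{-iπ/3}` through `0` to `∞ e^{iπ/3}`, written out in
real form on the two rays `z = r e^{±iπ/3}`, on which `z³ = -r³`. It is entire in `x` and agrees
with the improper integral `π⁻¹ ∫₀^∞ cos (r³/3 + x r) dr` for real `x`. -/
def Ai (x : ℝ) : ℝ :=
  Real.pi⁻¹ * ∫ r in Set.Ioi (0 : ℝ),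
    Real.exp (-r ^ 3 / 3 - x * r / 2) * Real.cos (Real.sqrt 3 / 2 * (x * r) + Real.pi / 6)

/-- The Airy function `Bi` on the real line, as the absolutely convergent contour integral
`(2π)⁻¹ (∫_{-∞}^{∞ e^{iπ/3}} + ∫_{-∞}^{∞ e^{-iπ/3}}) exp (z³/3 - x z) dz`, written out in real form
on the rays `z = -r` and `z = r e^{±iπ/3}`. It agrees with the improper integral
`π⁻¹ ∫₀^∞ (exp (-r³/3 + x r) + sin (r³/3 + x r)) dr` for real `x`. -/
def Bi (x : ℝ) : ℝ :=
  Real.pi⁻¹ * ∫ r in Set.Ioi (0 : ℝ),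
    (Real.exp (-r ^ 3 / 3 + x * r) +
      Real.exp (-r ^ 3 / 3 - x * r / 2) * Real.sin (Real.sqrt 3 / 2 * (x * r) + Real.pi / 6))

/-- `u` is the Hastings–McLeod solution of Painlevé II: the real solution of
`u'' = t u + 2 u³` on the whole line with `u(t) ~ Ai(t)` as `t → +∞` (which determines it). -/
structure IsHastingsMcLeod (u : ℝ → ℝ) : Prop where
  differentiable : Differentiable ℝ u
  painleve : ∀ t : ℝ, HasDerivAt (deriv u) (t * u t + 2 * u t ^ 3) t
  asymp : Asymptotics.IsEquivalent atTop u Ai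

/-- `T` is a possible value of the threshold `t₀ᴾ`: the exponential estimates hold for
`Ai, Ai', Bi, Bi'` at `x` and at `x / 3^{2/3}`, and for `u, u'` at `x`, for all `x ≥ T`;
moreover `T ≥ 1`. -/
structure IsThreshold (u : ℝ → ℝ) (T : ℝ) : Prop where
  one_le : 1 ≤ T
  bi : ∀ x : ℝ, T / (3 : ℝ) ^ (2 / 3 : ℝ) ≤ x →
    |Bi x| < Real.exp (2 / 3 * x ^ (3 / 2 : ℝ)) ∧
    |deriv Bi x| < Real.exp (2 / 3 * x ^ (3 / 2 : ℝ)) * Real.sqrt x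
  ai : ∀ x : ℝ, T / (3 : ℝ) ^ (2 / 3 : ℝ) ≤ x →
    |Ai x| < Real.exp (-(2 / 3 * x ^ (3 / 2 : ℝ))) ∧
    |deriv Ai x| < Real.exp (-(2 / 3 * x ^ (3 / 2 : ℝ))) * Real.sqrt x
  hm : ∀ x : ℝ, T ≤ x →
    |u x| < Real.exp (-(2 / 3 * x ^ (3 / 2 : ℝ))) ∧
    |deriv u x| < Real.exp (-(2 / 3 * x ^ (3 / 2 : ℝ))) * Real.sqrt x

/-- `∫_∞^t f(s) ds = -∫_t^∞ f(s) ds`. -/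
def intFromInfty (f : ℝ → ℝ) (t : ℝ) : ℝ := -∫ s in Set.Ioi t, f s

/-- `s / 3^{2/3}`. -/
def sc (s : ℝ) : ℝ := s / (3 : ℝ) ^ (2 / 3 : ℝ)

/-- `g₁(t) = Bi(t/3^{2/3})`, `g₂(t) = Ai(t/3^{2/3})`, `g₀(t) = 0`. -/
def g : Fin 3 → ℝ → ℝ :=
  ![fun _ => 0, fun t => Bi (sc t), fun t => Ai (sc t)]

/-- The Kronecker symbol `δ_k^0`. -/
def delta (k : Fin 3) : ℝ := if k = 0 then 1 else 0

/-! A triple `(φ₁, φ₂, φ₀)` of functions is a map `φ : Fin 3 → ℝ → ℝ`; `φ i` is `φ_i`. -/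

/-- The linear system
`φ₁' = -(2/3) φ₂`, `φ₂' = -(2/3) u φ₀ - (1/6) (t + 2 u²) φ₁`, `φ₀' = (1/3) u' φ₁ - (2/3) u φ₂`
on `[T, ∞)` (one-sided derivatives at `T`). -/
def IsSolutionOn (u : ℝ → ℝ) (T : ℝ) (φ : Fin 3 → ℝ → ℝ) : Prop :=
  ∀ t : ℝ, T ≤ t →
    HasDerivWithinAt (φ 1) (-(2 / 3) * φ 2 t) (Set.Ici T) t ∧
    HasDerivWithinAt (φ 2) (-(2 / 3) * u t * φ 0 t - 1 / 6 * (t + 2 * u t ^ 2) * φ 1 t)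
      (Set.Ici T) t ∧
    HasDerivWithinAt (φ 0) (1 / 3 * deriv u t * φ 1 t - 2 / 3 * u t * φ 2 t) (Set.Ici T) t

/-- `-(2/3) u(s) φ₀(s) - (1/3) u(s)² φ₁(s)`. -/
def source (u : ℝ → ℝ) (φ : Fin 3 → ℝ → ℝ) (s : ℝ) : ℝ :=
  -(2 / 3) * u s * φ 0 s - 1 / 3 * u s ^ 2 * φ 1 s

/-- Right-hand side of the integral equation for `Φ_{1k}`. -/
def rhsOne (u : ℝ → ℝ) (k : Fin 3) (φ : Fin 3 → ℝ → ℝ) (t : ℝ) : ℝ :=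
  g k t + 2 * Real.pi / (3 : ℝ) ^ (1 / 3 : ℝ) *
    (Ai (sc t) * intFromInfty (fun s => Bi (sc s) * source u φ s) t -
      Bi (sc t) * intFromInfty (fun s => Ai (sc s) * source u φ s) t)

/-- Right-hand side of the integral equation for `Φ_{2k}`. -/
def rhsTwo (u : ℝ → ℝ) (k : Fin 3) (φ : Fin 3 → ℝ → ℝ) (t : ℝ) : ℝ :=
  -(3 / 2) * deriv (g k) t - Real.pi *
    (deriv Ai (sc t) * intFromInfty (fun s => Bi (sc s) * source u φ s) t -
      deriv Bi (sc t) * intFromInfty (fun s => Ai (sc s) * source u φ s) t)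

/-- Right-hand side of the integral equation for `Φ_{0k}`. -/
def rhsZero (u : ℝ → ℝ) (k : Fin 3) (φ₁ φ₂ : ℝ → ℝ) (t : ℝ) : ℝ :=
  delta k + intFromInfty (fun s => 1 / 3 * deriv u s * φ₁ s - 2 / 3 * u s * φ₂ s) t

/-- All integrals in the three right-hand sides converge absolutely for `t ≥ T`. -/
def IntegralsConverge (u : ℝ → ℝ) (T : ℝ) (φ : Fin 3 → ℝ → ℝ) : Prop :=
  IntegrableOn (fun s => Bi (sc s) * source u φ s) (Set.Ioi T) ∧
  IntegrableOn (fun s => Ai (sc s) * source u φ s) (Set.Ioi T) ∧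
  IntegrableOn (fun s => 1 / 3 * deriv u s * φ 1 s - 2 / 3 * u s * φ 2 s) (Set.Ioi T)

/-- `φ = (Φ_{1k}, Φ_{2k}, Φ_{0k})` solves the `k`-th system of integral equations on `[T, ∞)`. -/
def SolvesIntegralEquations (u : ℝ → ℝ) (T : ℝ) (k : Fin 3) (φ : Fin 3 → ℝ → ℝ) : Prop :=
  IntegralsConverge u T φ ∧
  ∀ t : ℝ, T ≤ t →
    φ 1 t = rhsOne u k φ t ∧ φ 2 t = rhsTwo u k φ t ∧ φ 0 t = rhsZero u k (φ 1) (φ 2) t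

/-- The Picard iterates: `iterate u k j i` is `Φ_{ik}^{(j)}`. The new `Φ_{0k}` is computed from the
new `Φ_{1k}` and `Φ_{2k}`. -/
def iterate (u : ℝ → ℝ) (k : Fin 3) : ℕ → Fin 3 → ℝ → ℝ
  | 0 =>
    let p₁ : ℝ → ℝ := fun t => (1 - delta k) * g k t
    let p₂ : ℝ → ℝ := fun t => -(3 / 2) * (1 - delta k) * deriv (g k) t
    ![rhsZero u k p₁ p₂, p₁, p₂]
  | j + 1 =>
    let p₁ : ℝ → ℝ := rhsOne u k (iterate u k j)
    let p₂ : ℝ → ℝ := rhsTwo u k (iterate u k j)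
    ![rhsZero u k p₁ p₂, p₁, p₂]

/-- The constants `C_{1k}^{(j)}`, `j ≥ 1`. -/
def C₁ (k : Fin 3) (j : ℕ) : ℝ :=
  Real.pi ^ j * (3 : ℝ) ^ (-(j : ℝ) / 3) *
    ![3 / ((j - 1).factorial : ℝ) * ∏ i ∈ Finset.Icc 1 j, (2 * (i : ℝ) - 1) / (3 * (i : ℝ) - 2),
      ∏ i ∈ Finset.Icc 1 j, (6 * (i : ℝ) - 1) / ((3 * (i : ℝ) - 1) * (3 * (i : ℝ) - 2)),
      ∏ i ∈ Finset.Icc 1 j, (6 * (i : ℝ) + 1) / (3 * (i : ℝ) * (3 * (i : ℝ) - 1))] k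

/-- The constants `C_{2k}^{(j)}`, `j ≥ 1`. -/
def C₂ (k : Fin 3) (j : ℕ) : ℝ := C₁ k j / 2

/-- The constants `C_{0k}^{(j)}`, `j ≥ 1`. -/
def C₀ (k : Fin 3) (j : ℕ) : ℝ :=
  Real.pi ^ j * (3 : ℝ) ^ (-(j : ℝ) / 3) *
    ![1 / (j.factorial : ℝ) * ∏ i ∈ Finset.Icc 1 j, (2 * (i : ℝ) - 1) / (3 * (i : ℝ) - 2),
      ∏ i ∈ Finset.Icc 1 j, (6 * (i : ℝ) - 1) / ((3 * (i : ℝ) - 1) * (3 * (i : ℝ) + 1)),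
      1 / 2 * ∏ i ∈ Finset.Icc 1 j, (6 * (i : ℝ) + 1) / (3 * (i : ℝ) * (3 * (i : ℝ) + 2))] k

/-- The explicit exponential bounds on `Φ_{ik}^{(j+1)}(t) - Φ_{ik}^{(j)}(t)`. -/
def DifferenceBounds (u : ℝ → ℝ) (k : Fin 3) (j : ℕ) (t : ℝ) : Prop :=
  |iterate u k (j + 1) 1 t - iterate u k j 1 t| <
    C₁ k (j + 1) *
      Real.exp (-(4 / 3 * (j : ℝ) + 4 / 9 * ((k : ℕ) : ℝ) + 2 / 3) * t ^ (3 / 2 : ℝ)) ∧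
  |iterate u k (j + 1) 2 t - iterate u k j 2 t| <
    C₂ k (j + 1) * Real.sqrt t *
      Real.exp (-(4 / 3 * (j : ℝ) + 4 / 9 * ((k : ℕ) : ℝ) + 2 / 3) * t ^ (3 / 2 : ℝ)) ∧
  |iterate u k (j + 1) 0 t - iterate u k j 0 t| <
    C₀ k (j + 1) *
      Real.exp (-(4 / 3 * (j : ℝ) + 4 / 9 * ((k : ℕ) : ℝ) + 4 / 3) * t ^ (3 / 2 : ℝ))

end

end AiryPicard

open AiryPicard

namespace AiryPicard

/-! The integrals split off an exactly solvable part of the linear system. With the source `source u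
φ` frozen, `φ₁` satisfies a forced Airy equation in `t / 3^{2/3}`, and variation of constants with
`Ai`, `Bi` gives the recursion. Three ingredients are needed: the Airy equation and the Wronskian
`1/π`, decay at infinity, and a contraction with explicit constants.

Airy facts. Both functions are real or imaginary parts of moments `∫ rⁿ exp(-r³/3 + ωxr) dr`.
Differentiation raises `n` by one, and one integration by parts (`airyMoment_two`) turns the second
moment back into the zeroth, which is the Airy equation. The `wronskian` is constant and is
evaluated at `0` by the reflection formula for `Γ`. A threshold exists because `Ai = o(e^{-ζ})` and
`Bi = o(e^{ζ})`, where `ζ = (2/3)x^{3/2}`. The first comes from a monotone energy (`airy_decay`),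
the second from Laplace's method. Derivatives are then controlled by integrating the second-order
equations, and `u` inherits its decay from `u ~ Ai`.

Contraction. The recursion is affine, so the difference of successive iterates, `incr`, obeys the
homogeneous recursion. All estimates have the form `√s e^{-a s^{3/2}}`, which has the exact
antiderivative `-(2/(3a)) e^{-a s^{3/2}}`. Each step therefore gives an explicit constant. With `n =
3j + k` the constants satisfy `C₁ = n C₀` and gain the factor `(π/3^{1/3})(2n+3)/((n+1)(n+3))` in
`C₀`; `boundOne_eq`, `C₀_succ` and `C₁_succ` match this with the stated products. The induction step
is `incr_succ_lt`.

Limit. Since `t ≥ 1`, increments relative to fixed weights are dominated by a geometric series of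
ratio `2e^{-8/9} < 1`. Dominated convergence passes the recursion to the limit, and the Wronskian
turns the integral equations into the linear system. In a linear relation between the three triples
the source cancels, so the integral terms disappear. What remains at `T` is a relation between the
inhomogeneities, and the Wronskian excludes it. -/

open Set Complex in
/-- The moments `∫₀^∞ rⁿ exp (-r³/3 + ω x r) dr`. -/
noncomputable def airyMoment (ω : ℂ) (n : ℕ) (x : ℝ) : ℂ :=
  ∫ r in Ioi (0 : ℝ), (r : ℂ) ^ n * cexp (-(r : ℂ) ^ 3 / 3 + ω * x * r)

/-! ### Moments of the cubic exponential: convergence, derivative, integration by parts. -/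

section Moments

open Set

/-- The left side is maximal at `r = B`: the difference of the two sides is `(r - B)²(r + 2B)/3`. -/
theorem neg_cube_add_le {B r : ℝ} (hB : 0 ≤ B) (hr : 0 ≤ r) :
    -r ^ 3 / 3 + B ^ 2 * r ≤ 2 * B ^ 3 / 3 := by
  nlinarith [mul_nonneg (sq_nonneg (r - B)) (by positivity : 0 ≤ r + 2 * B)]

theorem integrableOn_pow_mul_exp_neg_cube (n : ℕ) (c : ℝ) :
    IntegrableOn (fun r : ℝ => r ^ n * Real.exp (-r ^ 3 / 3 + c * r)) (Ioi 0) := by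
  -- Chosen so that `c + 2 ≤ B²`. The exponent is then at most a constant minus `2r`; one factor
  -- `e^{-r}` absorbs `rⁿ` and the other is integrable.
  set B : ℝ := |c| + 3 with hB
  have hB0 : 0 ≤ B := by positivity
  have hcB : c + 2 ≤ B ^ 2 := by nlinarith [abs_nonneg c, le_abs_self c]
  refine Integrable.mono'
    ((exp_neg_integrableOn_Ioi 0 one_pos).const_mul (n.factorial * Real.exp (2 * B ^ 3 / 3)))
    (by fun_prop) ?_
  refine (ae_restrict_iff' measurableSet_Ioi).2 (ae_of_all _ fun r (hr : 0 < r) => ?_)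
  rw [Real.norm_of_nonneg (by positivity)]
  have h1 : r ^ n ≤ n.factorial * Real.exp r := by
    have := Real.pow_div_factorial_le_exp r hr.le n
    rwa [div_le_iff₀ (by positivity), mul_comm] at this
  have h2 : Real.exp (-r ^ 3 / 3 + c * r) ≤ Real.exp (2 * B ^ 3 / 3 - 2 * r) := by
    refine Real.exp_le_exp.2 ?_
    nlinarith [neg_cube_add_le hB0 hr.le]
  calc _ ≤ n.factorial * Real.exp r * Real.exp (2 * B ^ 3 / 3 - 2 * r) := by gcongr
    _ = _ := by
      rw [mul_assoc, mul_assoc, ← Real.exp_add, ← Real.exp_add]; ring_nf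

theorem norm_airyMoment_integrand (ω : ℂ) (n : ℕ) (x : ℝ) {r : ℝ} (hr : 0 ≤ r) :
    ‖(r : ℂ) ^ n * Complex.exp (-(r : ℂ) ^ 3 / 3 + ω * x * r)‖ =
      r ^ n * Real.exp (-r ^ 3 / 3 + ω.re * x * r) := by
  have : (-(r : ℂ) ^ 3 / 3 + ω * x * r).re = -r ^ 3 / 3 + ω.re * x * r := by
    have : (-(r : ℂ) ^ 3 / 3 + ω * x * r) = ((-r ^ 3 / 3 : ℝ) : ℂ) + ω * ((x * r : ℝ) : ℂ) := by
      push_cast; ring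
    rw [this, Complex.add_re, Complex.ofReal_re, Complex.re_mul_ofReal]; ring
  rw [norm_mul, norm_pow, Complex.norm_exp, this, Complex.norm_real, Real.norm_of_nonneg hr]

theorem integrableOn_airyMoment_integrand (ω : ℂ) (n : ℕ) (x : ℝ) :
    IntegrableOn (fun r : ℝ => (r : ℂ) ^ n * Complex.exp (-(r : ℂ) ^ 3 / 3 + ω * x * r))
      (Ioi 0) := by
  refine Integrable.mono' (integrableOn_pow_mul_exp_neg_cube n (ω.re * x)) (by fun_prop) ?_
  refine (ae_restrict_iff' measurableSet_Ioi).2 (ae_of_all _ fun r (hr : 0 < r) => ?_)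
  rw [norm_airyMoment_integrand ω n x hr.le]

theorem norm_airyMoment_le (ω : ℂ) (n : ℕ) (x : ℝ) :
    ‖airyMoment ω n x‖ ≤
      ∫ r in Ioi (0 : ℝ), r ^ n * Real.exp (-r ^ 3 / 3 + ω.re * x * r) := by
  refine (norm_integral_le_integral_norm _).trans_eq ?_
  exact setIntegral_congr_fun measurableSet_Ioi
    fun r (hr : 0 < r) => norm_airyMoment_integrand ω n x hr.le

/-- Differentiation under the integral sign. For `|y - x| < 1` the growth rate `ω.re * y` is at most
`‖ω‖(|x| + 1)`, which gives one integrable majorant. -/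
theorem hasDerivAt_airyMoment (ω : ℂ) (n : ℕ) (x : ℝ) :
    HasDerivAt (airyMoment ω n) (ω * airyMoment ω (n + 1) x) x := by
  have key := hasDerivAt_integral_of_dominated_loc_of_deriv_le (μ := volume.restrict (Ioi (0 : ℝ)))
    (F := fun (y : ℝ) (r : ℝ) => (r : ℂ) ^ n * Complex.exp (-(r : ℂ) ^ 3 / 3 + ω * y * r))
    (F' := fun (y : ℝ) (r : ℝ) =>
      ω * ((r : ℂ) ^ (n + 1) * Complex.exp (-(r : ℂ) ^ 3 / 3 + ω * y * r)))
    (x₀ := x) (s := Metric.ball x 1)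
    (bound := fun r => ‖ω‖ * (r ^ (n + 1) * Real.exp (-r ^ 3 / 3 + ‖ω‖ * (|x| + 1) * r)))
    (Metric.ball_mem_nhds x one_pos) (Eventually.of_forall fun y => by fun_prop)
    (integrableOn_airyMoment_integrand ω n x) (by fun_prop) ?_
    ((integrableOn_pow_mul_exp_neg_cube _ _).const_mul _) ?_
  · have h := key.2
    rw [integral_const_mul] at h
    exact h
  · refine (ae_restrict_iff' measurableSet_Ioi).2 (ae_of_all _ fun r (hr : 0 < r) y hy => ?_)
    rw [norm_mul, norm_airyMoment_integrand ω _ y hr.le]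
    have hy' : |y| ≤ |x| + 1 := by
      have h1 : |y - x| < 1 := by simpa [Real.dist_eq] using hy
      have h2 := abs_sub_abs_le_abs_sub y x
      linarith
    have h3 : ω.re * y ≤ ‖ω‖ * (|x| + 1) :=
      calc ω.re * y ≤ |ω.re * y| := le_abs_self _
        _ = |ω.re| * |y| := abs_mul _ _
        _ ≤ _ := mul_le_mul (Complex.abs_re_le_norm ω) hy' (abs_nonneg _) (norm_nonneg _)
    gcongr
  · refine ae_of_all _ fun r y _ => ?_
    have h1 : HasDerivAt (fun y : ℝ => -(r : ℂ) ^ 3 / 3 + ω * y * r) (ω * r) y := by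
      have h0 : HasDerivAt (fun y : ℝ => (y : ℂ)) 1 y := Complex.ofRealCLM.hasDerivAt
      simpa using ((h0.const_mul ω).mul_const (r : ℂ)).const_add (-(r : ℂ) ^ 3 / 3)
    convert! (h1.cexp.const_mul ((r : ℂ) ^ n)) using 1
    ring

/-- Integrate the derivative of `exp(-r³/3 + ωxr)` over the half-line: it vanishes at infinity, and
its value `1` at `r = 0` is the boundary term. -/
theorem airyMoment_two (ω : ℂ) (x : ℝ) :
    airyMoment ω 2 x = ω * x * airyMoment ω 0 x + 1 := by
  have hd : ∀ r : ℝ, HasDerivAt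
      (fun r : ℝ => Complex.exp (-(r : ℂ) ^ 3 / 3 + ω * x * r))
      (-((r : ℂ) ^ 2 * Complex.exp (-(r : ℂ) ^ 3 / 3 + ω * x * r)) +
        ω * x * ((r : ℂ) ^ 0 * Complex.exp (-(r : ℂ) ^ 3 / 3 + ω * x * r))) r := by
    intro r
    have h0 : HasDerivAt (fun y : ℝ => (y : ℂ)) 1 r := Complex.ofRealCLM.hasDerivAt
    have h1 := (((h0.pow 3).neg.div_const 3).add (h0.const_mul (ω * x))).cexp
    convert! h1 using 1
    simp
    ring
  have hint := (integrableOn_airyMoment_integrand ω 2 x).neg.add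
    ((integrableOn_airyMoment_integrand ω 0 x).const_mul (ω * x))
  have hlim : Tendsto (fun r : ℝ => Complex.exp (-(r : ℂ) ^ 3 / 3 + ω * x * r)) atTop (𝓝 0) := by
    set B : ℝ := |ω.re * x| + 3 with hB
    have hB0 : 0 ≤ B := by positivity
    have hcB : ω.re * x + 2 ≤ B ^ 2 := by
      nlinarith [abs_nonneg (ω.re * x), le_abs_self (ω.re * x)]
    have hg : Tendsto (fun r : ℝ => Real.exp (2 * B ^ 3 / 3) * Real.exp (-r)) atTop (𝓝 0) := by
      simpa using Real.tendsto_exp_neg_atTop_nhds_zero.const_mul (Real.exp (2 * B ^ 3 / 3))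
    refine squeeze_zero_norm' ?_ hg
    filter_upwards [eventually_ge_atTop 0] with r hr
    have := norm_airyMoment_integrand ω 0 x hr
    rw [pow_zero, pow_zero, one_mul, one_mul] at this
    rw [this, ← Real.exp_add]
    refine Real.exp_le_exp.2 ?_
    nlinarith [neg_cube_add_le hB0 hr]
  have h := integral_Ioi_of_hasDerivAt_of_tendsto' (a := 0) (fun r _ => hd r) hint hlim
  have e := integral_add (integrableOn_airyMoment_integrand ω 2 x).neg
    ((integrableOn_airyMoment_integrand ω 0 x).const_mul (ω * x))
  simp only [Pi.neg_apply] at e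
  rw [e, integral_neg, integral_const_mul] at h
  simp only [Complex.ofReal_zero, mul_zero, add_zero] at h
  have h' : -airyMoment ω 2 x + ω * x * airyMoment ω 0 x = -1 := by
    rw [airyMoment, airyMoment, h]; simp
  linear_combination -h'

end Moments

/-! ### The Airy equation and the Wronskian. -/

section AiryFunctions

open Set

/-- The primitive cube root of unity `exp (2πi/3)`. -/
noncomputable def cubeRoot : ℂ := ⟨-1 / 2, Real.sqrt 3 / 2⟩

/-- The twelfth root of unity `exp (πi/6)`. -/
noncomputable def twelfthRoot : ℂ := ⟨Real.sqrt 3 / 2, 1 / 2⟩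

theorem sqrt_three_mul_self : Real.sqrt 3 * Real.sqrt 3 = 3 :=
  Real.mul_self_sqrt (by norm_num)

theorem cubeRoot_pow_three : cubeRoot ^ 3 = 1 := by
  have h := sqrt_three_mul_self
  apply Complex.ext <;> simp [cubeRoot, pow_succ]
  · linear_combination 3 / 8 * h
  · linear_combination -(Real.sqrt 3 / 8) * h

theorem twelfthRoot_mul_cubeRoot_sq : twelfthRoot * cubeRoot ^ 2 = -Complex.I := by
  have h := sqrt_three_mul_self
  apply Complex.ext <;> simp [cubeRoot, twelfthRoot, pow_succ]
  · linear_combination -(Real.sqrt 3 / 8) * h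
  · linear_combination -(3 / 8) * h

theorem twelfthRoot_eq : twelfthRoot = Complex.exp ((Real.pi / 6 : ℝ) * Complex.I) := by
  rw [Complex.exp_mul_I, ← Complex.ofReal_cos, ← Complex.ofReal_sin, Real.cos_pi_div_six,
    Real.sin_pi_div_six]
  apply Complex.ext <;> simp [twelfthRoot]

/-- The two oscillating integrands of `Ai` and `Bi` are the real and imaginary parts of one complex
exponential, so both functions can be treated through a single moment. -/
theorem twelfthRoot_mul_integrand (x r : ℝ) :
    twelfthRoot * ((r : ℂ) ^ 0 * Complex.exp (-(r : ℂ) ^ 3 / 3 + cubeRoot * x * r)) =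
      ⟨Real.exp (-r ^ 3 / 3 - x * r / 2) *
          Real.cos (Real.sqrt 3 / 2 * (x * r) + Real.pi / 6),
        Real.exp (-r ^ 3 / 3 - x * r / 2) *
          Real.sin (Real.sqrt 3 / 2 * (x * r) + Real.pi / 6)⟩ := by
  have h : cubeRoot = ((-1 / 2 : ℝ) : ℂ) + ((Real.sqrt 3 / 2 : ℝ) : ℂ) * Complex.I := by
    apply Complex.ext <;> simp [cubeRoot]
  have h2 : ((Real.pi / 6 : ℝ) : ℂ) * Complex.I +
      (-(r : ℂ) ^ 3 / 3 + cubeRoot * x * r) =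
      ((-r ^ 3 / 3 - x * r / 2 : ℝ) : ℂ) +
        ((Real.sqrt 3 / 2 * (x * r) + Real.pi / 6 : ℝ) : ℂ) * Complex.I := by
    rw [h]; push_cast; ring
  rw [pow_zero, one_mul, twelfthRoot_eq, ← Complex.exp_add, h2, Complex.exp_add,
    Complex.exp_mul_I, ← Complex.ofReal_exp, ← Complex.ofReal_cos, ← Complex.ofReal_sin]
  apply Complex.ext <;>
  simp only [Complex.re_ofReal_mul, Complex.im_ofReal_mul, Complex.add_re, Complex.add_im,
    Complex.ofReal_re, Complex.ofReal_im, Complex.I_re, Complex.I_im] <;>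
  ring

theorem Ai_eq (x : ℝ) : Ai x = Real.pi⁻¹ * (twelfthRoot * airyMoment cubeRoot 0 x).re := by
  rw [airyMoment, ← integral_const_mul, Ai]
  congr 1
  refine Eq.trans ?_ (integral_re (𝕜 := ℂ)
    ((integrableOn_airyMoment_integrand cubeRoot 0 x).const_mul twelfthRoot))
  refine integral_congr_ae (ae_of_all _ fun r => ?_)
  simp only [twelfthRoot_mul_integrand]
  rfl

theorem Bi_eq (x : ℝ) : Bi x = Real.pi⁻¹ *
    ((airyMoment 1 0 x).re + (twelfthRoot * airyMoment cubeRoot 0 x).im) := by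
  rw [airyMoment, airyMoment, ← integral_const_mul, Bi]
  congr 1
  have i1 := integrableOn_airyMoment_integrand 1 0 x
  have i2 := (integrableOn_airyMoment_integrand cubeRoot 0 x).const_mul twelfthRoot
  have e1 := integral_re (𝕜 := ℂ) i1
  have e2 := integral_im (𝕜 := ℂ) i2
  refine Eq.trans ?_ (congrArg₂ (· + ·) e1 e2)
  rw [← integral_add i1.re i2.im]
  refine integral_congr_ae (ae_of_all _ fun r => ?_)
  simp only [twelfthRoot_mul_integrand]
  congr 1
  have : -(r : ℂ) ^ 3 / 3 + 1 * x * r = ((-r ^ 3 / 3 + x * r : ℝ) : ℂ) := by push_cast; ring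
  rw [pow_zero, one_mul, this, ← Complex.ofReal_exp]
  rfl

theorem hasDerivAt_re {f : ℝ → ℂ} {f' : ℂ} {x : ℝ} (h : HasDerivAt f f' x) :
    HasDerivAt (fun y => (f y).re) f'.re x :=
  (Complex.reCLM.hasFDerivAt.comp_hasDerivAt x h)

theorem hasDerivAt_im {f : ℝ → ℂ} {f' : ℂ} {x : ℝ} (h : HasDerivAt f f' x) :
    HasDerivAt (fun y => (f y).im) f'.im x :=
  (Complex.imCLM.hasFDerivAt.comp_hasDerivAt x h)

theorem hasDerivAt_Ai' (x : ℝ) : HasDerivAt Ai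
    (Real.pi⁻¹ * (twelfthRoot * (cubeRoot * airyMoment cubeRoot 1 x)).re) x := by
  rw [funext Ai_eq]
  exact (hasDerivAt_re ((hasDerivAt_airyMoment cubeRoot 0 x).const_mul twelfthRoot)).const_mul _

theorem deriv_Ai (x : ℝ) :
    deriv Ai x = Real.pi⁻¹ * (twelfthRoot * (cubeRoot * airyMoment cubeRoot 1 x)).re :=
  (hasDerivAt_Ai' x).deriv

theorem hasDerivAt_Bi' (x : ℝ) : HasDerivAt Bi
    (Real.pi⁻¹ * ((1 * airyMoment 1 1 x).re +
      (twelfthRoot * (cubeRoot * airyMoment cubeRoot 1 x)).im)) x := by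
  rw [funext Bi_eq]
  exact ((hasDerivAt_re (hasDerivAt_airyMoment 1 0 x)).add
    (hasDerivAt_im ((hasDerivAt_airyMoment cubeRoot 0 x).const_mul twelfthRoot))).const_mul _

theorem deriv_Bi (x : ℝ) :
    deriv Bi x = Real.pi⁻¹ * ((1 * airyMoment 1 1 x).re +
      (twelfthRoot * (cubeRoot * airyMoment cubeRoot 1 x)).im) :=
  (hasDerivAt_Bi' x).deriv

theorem hasDerivAt_Ai (x : ℝ) : HasDerivAt Ai (deriv Ai x) x :=
  (hasDerivAt_Ai' x).differentiableAt.hasDerivAt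

theorem hasDerivAt_Bi (x : ℝ) : HasDerivAt Bi (deriv Bi x) x :=
  (hasDerivAt_Bi' x).differentiableAt.hasDerivAt

/-- The boundary term of the integration by parts becomes `e^{iπ/6} e^{4πi/3} = -i`. Its real part
vanishes, so `Ai` solves the Airy equation; its imaginary part `-1` cancels the boundary term `+1`
of the real moment in `Bi`. -/
theorem cubeRoot_term (x : ℝ) :
    twelfthRoot * (cubeRoot * (cubeRoot * airyMoment cubeRoot 2 x)) =
      (x : ℂ) * (twelfthRoot * airyMoment cubeRoot 0 x) - Complex.I := by
  rw [airyMoment_two]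
  linear_combination (twelfthRoot * x * airyMoment cubeRoot 0 x) * cubeRoot_pow_three +
    twelfthRoot_mul_cubeRoot_sq

theorem hasDerivAt_deriv_Ai (x : ℝ) : HasDerivAt (deriv Ai) (x * Ai x) x := by
  have h := (hasDerivAt_re (((hasDerivAt_airyMoment cubeRoot 1 x).const_mul cubeRoot).const_mul
    twelfthRoot)).const_mul Real.pi⁻¹
  rw [← funext deriv_Ai, cubeRoot_term] at h
  convert! h using 1
  rw [Ai_eq]
  simp only [Complex.sub_re, Complex.re_ofReal_mul, Complex.I_re]
  ring

theorem hasDerivAt_deriv_Bi (x : ℝ) : HasDerivAt (deriv Bi) (x * Bi x) x := by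
  have h := ((hasDerivAt_re ((hasDerivAt_airyMoment 1 1 x).const_mul 1)).add
    (hasDerivAt_im (((hasDerivAt_airyMoment cubeRoot 1 x).const_mul cubeRoot).const_mul
    twelfthRoot))).const_mul Real.pi⁻¹
  have e : (fun y : ℝ => Real.pi⁻¹ * ((1 * airyMoment 1 1 y).re +
      (twelfthRoot * (cubeRoot * airyMoment cubeRoot 1 y)).im)) = deriv Bi :=
    (funext deriv_Bi).symm
  change HasDerivAt (fun y : ℝ => Real.pi⁻¹ * ((1 * airyMoment 1 1 y).re +
      (twelfthRoot * (cubeRoot * airyMoment cubeRoot 1 y)).im)) _ x at h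
  rw [e, cubeRoot_term, airyMoment_two] at h
  convert! h using 1
  rw [Bi_eq]
  simp only [Complex.sub_im, Complex.im_ofReal_mul, Complex.I_im, one_mul, Complex.add_re,
    Complex.one_re, Complex.re_ofReal_mul]
  ring

theorem airyMoment_at_zero (ω : ℂ) (n : ℕ) : airyMoment ω n 0 =
    ((((1 : ℝ) / 3) ^ (-((n : ℝ) + 1) / 3) * (1 / 3) * Real.Gamma (((n : ℝ) + 1) / 3) : ℝ) : ℂ) := by
  rw [← integral_rpow_mul_exp_neg_mul_rpow (by norm_num)
    (by have : (0 : ℝ) ≤ n := n.cast_nonneg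
        linarith) (by norm_num), airyMoment, ← integral_complex_ofReal]
  refine integral_congr_ae (ae_of_all _ fun r => ?_)
  have h3 : r ^ (3 : ℝ) = r ^ 3 := by exact_mod_cast Real.rpow_natCast r 3
  simp only [Real.rpow_natCast, h3]
  push_cast
  congr 2
  ring

/-- At `x = 0` the moments are multiples of `Γ(1/3)` and `Γ(2/3)` and no longer depend on `ω`; the
reflection formula evaluates their product. Only this product enters the Wronskian at `0`. -/
theorem airyMoment_product :
    ∃ G₀ G₁ : ℝ, (∀ ω, airyMoment ω 0 0 = G₀) ∧ (∀ ω, airyMoment ω 1 0 = G₁) ∧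
      Real.sqrt 3 * (G₀ * G₁) * 3 = 2 * Real.pi := by
  refine ⟨_, _, fun ω => airyMoment_at_zero ω 0, fun ω => airyMoment_at_zero ω 1, ?_⟩
  have hG := Real.Gamma_mul_Gamma_one_sub (1 / 3)
  have hs : Real.sin (Real.pi * (1 / 3)) = Real.sqrt 3 / 2 := by
    rw [mul_one_div, Real.sin_pi_div_three]
  rw [hs] at hG
  have e1 : (((0 : ℕ) : ℝ) + 1) / 3 = 1 / 3 := by norm_num
  have e2 : (((1 : ℕ) : ℝ) + 1) / 3 = 1 - 1 / 3 := by norm_num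
  have hp : ((1 : ℝ) / 3) ^ (-(((0 : ℕ) : ℝ) + 1) / 3) *
      ((1 : ℝ) / 3) ^ (-(((1 : ℕ) : ℝ) + 1) / 3) = 3 := by
    rw [← Real.rpow_add (by norm_num)]
    norm_num
  rw [e1, e2]
  have h3 : (0 : ℝ) < Real.sqrt 3 := by positivity
  calc _ = Real.sqrt 3 * ((((1 : ℝ) / 3) ^ (-(((0 : ℕ) : ℝ) + 1) / 3) *
      ((1 : ℝ) / 3) ^ (-(((1 : ℕ) : ℝ) + 1) / 3)) * (1 / 9) *
        (Real.Gamma (1 / 3) * Real.Gamma (1 - 1 / 3))) * 3 := by ring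
    _ = _ := by
      rw [hp, hG]; field_simp; norm_num

/-- The derivative vanishes by the Airy equation, so it suffices to evaluate at `0`. -/
theorem wronskian (x : ℝ) : Ai x * deriv Bi x - deriv Ai x * Bi x = Real.pi⁻¹ := by
  have hd : ∀ y, HasDerivAt (fun y => Ai y * deriv Bi y - deriv Ai y * Bi y) 0 y := by
    intro y
    convert! ((hasDerivAt_Ai y).mul (hasDerivAt_deriv_Bi y)).sub
      ((hasDerivAt_deriv_Ai y).mul (hasDerivAt_Bi y)) using 1
    ring
  have hc := is_const_of_deriv_eq_zero (fun y => (hd y).differentiableAt) (fun y => (hd y).deriv)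
    x 0
  beta_reduce at hc
  rw [hc, Ai_eq, Bi_eq, deriv_Ai, deriv_Bi]
  obtain ⟨G₀, G₁, h0, h1, hG⟩ := airyMoment_product
  have hs := sqrt_three_mul_self
  have hpi := Real.pi_pos
  rw [h0, h1, h0, h1]
  simp [twelfthRoot, cubeRoot]
  field_simp
  linear_combination (4 : ℝ) * hG + G₀ * G₁ * Real.sqrt 3 * hs

end AiryFunctions

end AiryPicard

namespace AiryPicard

/-! ### Decay of solutions of second-order equations at infinity. -/

section Decay

open Set

theorem hasDerivAt_zeta {x : ℝ} (hx : 0 < x) :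
    HasDerivAt (fun x : ℝ => 2 / 3 * x ^ (3 / 2 : ℝ)) (Real.sqrt x) x := by
  convert! (Real.hasDerivAt_rpow_const (p := 3 / 2) (Or.inl hx.ne')).const_mul (2 / 3 : ℝ) using 1
  rw [Real.sqrt_eq_rpow]; norm_num; ring

theorem tendsto_zeta : Tendsto (fun x : ℝ => 2 / 3 * x ^ (3 / 2 : ℝ)) atTop atTop :=
  (tendsto_rpow_atTop (by norm_num)).const_mul_atTop (by norm_num)

theorem antitoneOn_Ici_of_hasDerivAt {f f' : ℝ → ℝ} {X : ℝ}
    (hf : ∀ x, X ≤ x → HasDerivAt f (f' x) x) (h : ∀ x, X ≤ x → f' x ≤ 0) :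
    AntitoneOn f (Ici X) := by
  refine antitoneOn_of_deriv_nonpos (convex_Ici X)
    (fun x hx => (hf x hx).continuousAt.continuousWithinAt)
    (fun x hx => (hf x (interior_subset hx)).differentiableAt.differentiableWithinAt)
    fun x hx => ?_
  rw [(hf x (interior_subset hx)).deriv]
  exact h x (interior_subset hx)

theorem monotoneOn_Ici_of_hasDerivAt {f f' : ℝ → ℝ} {X : ℝ}
    (hf : ∀ x, X ≤ x → HasDerivAt f (f' x) x) (h : ∀ x, X ≤ x → 0 ≤ f' x) :
    MonotoneOn f (Ici X) := by
  have := (antitoneOn_Ici_of_hasDerivAt (f := fun x => -f x) (f' := fun x => -f' x)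
    (fun x hx => (hf x hx).neg) (fun x hx => by simpa using h x hx))
  intro a ha b hb hab
  simpa using this ha hb hab

theorem one_le_sqrt_self {x : ℝ} (hx : 1 ≤ x) : 1 ≤ Real.sqrt x := by
  rw [Real.one_le_sqrt]; exact hx

/-- A solution of `y'' = x y` that is `O(1/x)` and has a bounded derivative satisfies
`y (y' + (√x + 1/(8x)) y) ≤ 0`. -/
theorem airy_energy_nonpos {y y' : ℝ → ℝ} (hy : ∀ x, HasDerivAt y (y' x) x)
    (hy' : ∀ x, HasDerivAt y' (x * y x) x) {K : ℝ} (hK : ∀ x, 1 ≤ x → |y x| ≤ K / x)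
    (hK' : ∀ x, 1 ≤ x → |y' x| ≤ K) {x : ℝ} (hx : 1 ≤ x) :
    y x * (y' x + (Real.sqrt x + 1 / 8 * x⁻¹) * y x) ≤ 0 := by
  -- The WKB rate would be `√x + 1/(4x)`. Half of the correction leaves `p' + x - p² ≥ 0` for `x ≥
  -- 1` and still gains a power of `x` later.
  set p : ℝ → ℝ := fun x => Real.sqrt x + 1 / 8 * x⁻¹ with hp
  have hdp : ∀ x, 1 ≤ x → HasDerivAt p (1 / (2 * Real.sqrt x) + 1 / 8 * (-(x ^ 2)⁻¹)) x :=
    fun x hx => (Real.hasDerivAt_sqrt (by positivity)).add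
      ((hasDerivAt_inv (by positivity)).const_mul _)
  -- The derivative equals `(y' + p y)² + (p' + x - p²) y²`, hence is nonnegative. An increasing
  -- function with limit `0` is nonpositive.
  have hmono : MonotoneOn (fun x => y x * (y' x + p x * y x)) (Ici 1) := by
    refine monotoneOn_Ici_of_hasDerivAt (f' := fun x => y' x * (y' x + p x * y x) +
      y x * (x * y x + ((1 / (2 * Real.sqrt x) + 1 / 8 * (-(x ^ 2)⁻¹)) * y x + p x * y' x)))
      (fun x hx => (hy x).mul ((hy' x).add ((hdp x hx).mul (hy x)))) fun x hx => ?_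
    have hs := one_le_sqrt_self hx
    have hss : Real.sqrt x ^ 2 = x := Real.sq_sqrt (by positivity)
    have hQ : 0 ≤ x + (1 / (2 * Real.sqrt x) + 1 / 8 * (-(x ^ 2)⁻¹)) - p x ^ 2 := by
      simp only [hp]
      generalize Real.sqrt x = s at hs hss
      subst hss
      have e : s ^ 2 + (1 / (2 * s) + 1 / 8 * (-((s ^ 2) ^ 2)⁻¹)) - (s + 1 / 8 * (s ^ 2)⁻¹) ^ 2 =
          (16 * s ^ 3 - 9) / (64 * s ^ 4) := by
        field_simp; ring
      rw [e]
      have : 1 ≤ s ^ 3 := one_le_pow₀ hs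
      exact div_nonneg (by linarith) (by positivity)
    have := mul_nonneg hQ (sq_nonneg (y x))
    nlinarith [sq_nonneg (y' x + p x * y x)]
  have hlim : Tendsto (fun x => y x * (y' x + p x * y x)) atTop (𝓝 0) := by
    have hg : Tendsto (fun x : ℝ => 3 * K ^ 2 * x⁻¹) atTop (𝓝 0) := by
      simpa only [mul_zero] using (tendsto_inv_atTop_zero (𝕜 := ℝ)).const_mul (3 * K ^ 2)
    refine squeeze_zero_norm' ?_ hg
    filter_upwards [eventually_ge_atTop 1] with x hx
    have hK0 : 0 ≤ K := (abs_nonneg _).trans (hK' x hx)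
    have hx0 : (0 : ℝ) < x := by linarith
    have hs := one_le_sqrt_self hx
    have hpx : 0 ≤ p x := by simp only [hp]; positivity
    have hpx' : p x ≤ 2 * x := by
      have h1 : Real.sqrt x ≤ x := by
        rw [Real.sqrt_le_left hx0.le]; nlinarith
      have h2 : x⁻¹ ≤ 1 := inv_le_one_of_one_le₀ hx
      simp only [hp]; linarith
    rw [Real.norm_eq_abs, abs_mul]
    have h1 : |y' x + p x * y x| ≤ 3 * K := by
      calc |y' x + p x * y x| ≤ |y' x| + |p x * y x| := abs_add_le _ _
        _ = |y' x| + p x * |y x| := by rw [abs_mul, abs_of_nonneg hpx]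
        _ ≤ K + 2 * x * (K / x) := by
          gcongr
          exacts [hK' x hx, hK x hx]
        _ = 3 * K := by field_simp; ring
    calc _ ≤ K / x * (3 * K) := by
          gcongr
          exact hK x hx
      _ = _ := by ring
  refine ge_of_tendsto hlim ?_
  filter_upwards [eventually_ge_atTop x] with z hz
  exact hmono hx (hx.trans hz) hz

/-- The logarithmic derivative of the weight `e^{2ζ} x^{1/4}` is `2(√x + 1/(8x))`. The energy
inequality therefore makes `y² e^{2ζ} x^{1/4}` decreasing, and the factor `x^{1/4}` yields the
arbitrary `ε`. -/
theorem airy_decay {y y' : ℝ → ℝ} (hy : ∀ x, HasDerivAt y (y' x) x)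
    (hy' : ∀ x, HasDerivAt y' (x * y x) x) {K : ℝ} (hK : ∀ x, 1 ≤ x → |y x| ≤ K / x)
    (hK' : ∀ x, 1 ≤ x → |y' x| ≤ K) {ε : ℝ} (hε : 0 < ε) :
    ∀ᶠ x in atTop, |y x| ≤ ε * Real.exp (-(2 / 3 * x ^ (3 / 2 : ℝ))) := by
  set G : ℝ → ℝ := fun x =>
    y x ^ 2 * Real.exp (2 * (2 / 3 * x ^ (3 / 2 : ℝ))) * x ^ (1 / 4 : ℝ) with hG
  have hanti : AntitoneOn G (Ici 1) := by
    refine antitoneOn_Ici_of_hasDerivAt (f' := fun x =>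
      2 * (Real.exp (2 * (2 / 3 * x ^ (3 / 2 : ℝ))) * x ^ (1 / 4 : ℝ)) *
        (y x * (y' x + (Real.sqrt x + 1 / 8 * x⁻¹) * y x))) (fun x hx => ?_) fun x hx => ?_
    · have hx0 : (0 : ℝ) < x := by linarith
      convert! (((hy x).pow 2).mul (((hasDerivAt_zeta hx0).const_mul 2).exp)).mul
        (Real.hasDerivAt_rpow_const (p := 1 / 4) (Or.inl hx0.ne')) using 1
      rw [Real.rpow_sub_one hx0.ne']
      simp
      field_simp
      ring
    · have hx0 : (0 : ℝ) < x := by linarith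
      exact mul_nonpos_of_nonneg_of_nonpos (by positivity) (airy_energy_nonpos hy hy' hK hK' hx)
  have hq : ∀ᶠ x : ℝ in atTop, G 1 / ε ^ 2 ≤ x ^ (1 / 4 : ℝ) :=
    (tendsto_rpow_atTop (by norm_num)).eventually_ge_atTop _
  filter_upwards [hq, eventually_ge_atTop 1] with x hx hx1
  have h1 : G x ≤ G 1 := hanti (self_mem_Ici) hx1 hx1
  have hx0 : (0 : ℝ) < x := by linarith
  rw [div_le_iff₀ (by positivity)] at hx
  have hq0 : (0 : ℝ) < x ^ (1 / 4 : ℝ) := by positivity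
  have h2 : y x ^ 2 * Real.exp (2 * (2 / 3 * x ^ (3 / 2 : ℝ))) ≤ ε ^ 2 := by
    have : (y x ^ 2 * Real.exp (2 * (2 / 3 * x ^ (3 / 2 : ℝ)))) * x ^ (1 / 4 : ℝ) ≤
        ε ^ 2 * x ^ (1 / 4 : ℝ) := by
      refine h1.trans (hx.trans_eq (mul_comm _ _))
    exact le_of_mul_le_mul_right this hq0
  refine abs_le_of_sq_le_sq ?_ (by positivity)
  rw [mul_pow, ← Real.exp_nat_mul]
  have h3 : Real.exp (2 * (2 / 3 * x ^ (3 / 2 : ℝ))) *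
      Real.exp (((2 : ℕ) : ℝ) * -(2 / 3 * x ^ (3 / 2 : ℝ))) = 1 := by
    rw [← Real.exp_add]; simp
  calc y x ^ 2 = y x ^ 2 * Real.exp (2 * (2 / 3 * x ^ (3 / 2 : ℝ))) *
        Real.exp (((2 : ℕ) : ℝ) * -(2 / 3 * x ^ (3 / 2 : ℝ))) := by rw [mul_assoc, h3, mul_one]
    _ ≤ _ := by gcongr

/-- The function `h = √x e^{-ζ}` satisfies `h' ≤ -(x/2) e^{-ζ}` for `x ≥ 1`, so `f + 2εh` decreases.
If it were negative somewhere, `f` would stay below a negative constant and `U` could not remain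
bounded. -/
theorem neg_le_of_deriv_le_exp {U f f' : ℝ → ℝ} {X ε K : ℝ} (hX : 1 ≤ X) (hε : 0 ≤ ε)
    (hU : ∀ x, X ≤ x → HasDerivAt U (f x) x) (hf : ∀ x, X ≤ x → HasDerivAt f (f' x) x)
    (hf' : ∀ x, X ≤ x → f' x ≤ ε * x * Real.exp (-(2 / 3 * x ^ (3 / 2 : ℝ))))
    (hK : ∀ x, X ≤ x → |U x| ≤ K) {x : ℝ} (hx : X ≤ x) :
    -(2 * ε * (Real.sqrt x * Real.exp (-(2 / 3 * x ^ (3 / 2 : ℝ))))) ≤ f x := by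
  set h : ℝ → ℝ := fun x => Real.sqrt x * Real.exp (-(2 / 3 * x ^ (3 / 2 : ℝ))) with hh
  have hdh : ∀ x, X ≤ x → HasDerivAt h
      ((1 / (2 * Real.sqrt x) - x) * Real.exp (-(2 / 3 * x ^ (3 / 2 : ℝ)))) x := by
    intro x hx
    have hx0 : 0 < x := by linarith
    convert! (Real.hasDerivAt_sqrt hx0.ne').mul ((hasDerivAt_zeta hx0).neg.exp) using 1
    have := Real.mul_self_sqrt hx0.le
    linear_combination (Real.exp (-(2 / 3 * x ^ (3 / 2 : ℝ)))) * this
  have hanti : AntitoneOn (fun x => f x + 2 * ε * h x) (Ici X) := by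
    refine antitoneOn_Ici_of_hasDerivAt (fun x hx => (hf x hx).add ((hdh x hx).const_mul _))
      fun x hx => ?_
    have hx1 : 1 ≤ x := hX.trans hx
    have hs := one_le_sqrt_self hx1
    have h1 : 1 / (2 * Real.sqrt x) ≤ 1 / 2 := by
      apply one_div_le_one_div_of_le <;> linarith
    have he := (Real.exp_pos (-(2 / 3 * x ^ (3 / 2 : ℝ)))).le
    have := mul_nonneg (mul_nonneg hε he) (by linarith : 0 ≤ x - 2 * (1 / (2 * Real.sqrt x)))
    have := hf' x hx
    nlinarith
  by_contra! hlt
  set c := -(f x + 2 * ε * h x) with hc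
  have hc0 : 0 < c := by simp only [hc, hh]; linarith
  have hfz : ∀ z, x ≤ z → f z ≤ -c := by
    intro z hz
    have h1 : f z + 2 * ε * h z ≤ f x + 2 * ε * h x := hanti hx (hx.trans hz) hz
    have h2 : 0 ≤ 2 * ε * h z := by simp only [hh]; positivity
    linarith
  have hU' : AntitoneOn (fun z => U z + c * z) (Ici x) :=
    antitoneOn_Ici_of_hasDerivAt (fun z hz => (hU z (hx.trans hz)).add
      ((hasDerivAt_id z).const_mul c)) fun z hz => by linarith [hfz z hz]
  have hK0 : 0 ≤ K := (abs_nonneg _).trans (hK x hx)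
  -- Over this length `U` would fall by at least `2K + 1`, while `|U| ≤ K` allows a drop of only
  -- `2K`.
  have hz : x ≤ x + (2 * K + 1) / c := by
    have : 0 ≤ (2 * K + 1) / c := by positivity
    linarith
  have h1 : U (x + (2 * K + 1) / c) + c * (x + (2 * K + 1) / c) ≤ U x + c * x :=
    hU' self_mem_Ici hz hz
  have h2 : c * (x + (2 * K + 1) / c) = c * x + (2 * K + 1) := by field_simp
  have h3 := (abs_le.1 (hK _ (hx.trans hz))).1
  have h4 := (abs_le.1 (hK _ hx)).2
  linarith

/-- If `U` is bounded and `|U''| ≤ ε x exp (-2/3 x^{3/2})`, then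
`|U'| ≤ 2 ε √x exp (-2/3 x^{3/2})`. -/
theorem abs_le_of_abs_deriv_le_exp {U f f' : ℝ → ℝ} {X ε K : ℝ} (hX : 1 ≤ X) (hε : 0 ≤ ε)
    (hU : ∀ x, X ≤ x → HasDerivAt U (f x) x) (hf : ∀ x, X ≤ x → HasDerivAt f (f' x) x)
    (hf' : ∀ x, X ≤ x → |f' x| ≤ ε * x * Real.exp (-(2 / 3 * x ^ (3 / 2 : ℝ))))
    (hK : ∀ x, X ≤ x → |U x| ≤ K) {x : ℝ} (hx : X ≤ x) :
    |f x| ≤ 2 * ε * (Real.sqrt x * Real.exp (-(2 / 3 * x ^ (3 / 2 : ℝ)))) := by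
  refine abs_le.2 ⟨neg_le_of_deriv_le_exp hX hε hU hf
    (fun x hx => (le_abs_self _).trans (hf' x hx)) hK hx, ?_⟩
  have := neg_le_of_deriv_le_exp (U := fun x => -U x) (f := fun x => -f x) (f' := fun x => -f' x)
    hX hε (fun x hx => (hU x hx).neg) (fun x hx => (hf x hx).neg)
    (fun x hx => (neg_le_abs _).trans (hf' x hx)) (fun x hx => by simpa using hK x hx) hx
  linarith

end Decay

/-! ### Exponential bounds for the Airy functions and existence of a threshold. -/

section AiryBounds

open Set

theorem norm_airyMoment_cubeRoot_zero_le {x : ℝ} (hx : 0 < x) :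
    ‖airyMoment cubeRoot 0 x‖ ≤ 2 / x := by
  refine (norm_airyMoment_le _ _ _).trans ?_
  have hi : ∫ r in Ioi (0 : ℝ), Real.exp (-(x / 2) * r) = 2 / x := by
    rw [integral_exp_mul_Ioi (by linarith)]
    simp
  rw [← hi]
  refine setIntegral_mono_on (integrableOn_pow_mul_exp_neg_cube 0 _)
    (integrableOn_exp_mul_Ioi (by linarith) 0) measurableSet_Ioi fun r (hr : 0 < r) => ?_
  rw [pow_zero, one_mul]
  refine Real.exp_le_exp.2 ?_
  simp only [cubeRoot]
  have : 0 < r ^ 3 := by positivity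
  nlinarith

theorem norm_airyMoment_cubeRoot_le (n : ℕ) {x : ℝ} (hx : 0 ≤ x) :
    ‖airyMoment cubeRoot n x‖ ≤ ∫ r in Ioi (0 : ℝ), r ^ n * Real.exp (-r ^ 3 / 3 + 0 * r) := by
  refine (norm_airyMoment_le _ _ _).trans ?_
  refine setIntegral_mono_on (integrableOn_pow_mul_exp_neg_cube n _)
    (integrableOn_pow_mul_exp_neg_cube n _) measurableSet_Ioi fun r (hr : 0 < r) => ?_
  refine mul_le_mul_of_nonneg_left (Real.exp_le_exp.2 ?_) (by positivity)
  simp only [cubeRoot]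
  have := mul_nonneg hx hr.le
  linarith

theorem inv_pi_le_one : Real.pi⁻¹ ≤ 1 :=
  inv_le_one_of_one_le₀ (by linarith [Real.pi_gt_three])

/-- Dropping the cubic term bounds the zeroth moment by `2/x`, and the first moment is bounded by
its value at `x = 0`. These crude bounds are all that `airy_decay` needs. -/
theorem Ai_isLittleO {ε : ℝ} (hε : 0 < ε) :
    ∀ᶠ x in atTop, |Ai x| ≤ ε * Real.exp (-(2 / 3 * x ^ (3 / 2 : ℝ))) := by
  set M := ∫ r in Ioi (0 : ℝ), r ^ 1 * Real.exp (-r ^ 3 / 3 + 0 * r) with hM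
  have hM0 : 0 ≤ M := setIntegral_nonneg measurableSet_Ioi fun r (hr : 0 < r) => by positivity
  refine airy_decay (K := 2 * ‖twelfthRoot‖ + ‖twelfthRoot‖ * ‖cubeRoot‖ * M) hasDerivAt_Ai
    hasDerivAt_deriv_Ai (fun x hx => ?_) (fun x hx => ?_) hε
  · rw [Ai_eq, abs_mul, abs_of_pos (by positivity : 0 < Real.pi⁻¹)]
    have hx0 : 0 < x := by linarith
    calc _ ≤ 1 * ‖twelfthRoot * airyMoment cubeRoot 0 x‖ := by
          gcongr
          exacts [inv_pi_le_one, Complex.abs_re_le_norm _]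
      _ ≤ 1 * (‖twelfthRoot‖ * (2 / x)) := by
          rw [norm_mul]; gcongr; exact norm_airyMoment_cubeRoot_zero_le hx0
      _ = (2 * ‖twelfthRoot‖ + 0) / x := by ring
      _ ≤ _ := by gcongr; positivity
  · rw [deriv_Ai, abs_mul, abs_of_pos (by positivity : 0 < Real.pi⁻¹)]
    have hx0 : 0 ≤ x := by linarith
    calc _ ≤ 1 * ‖twelfthRoot * (cubeRoot * airyMoment cubeRoot 1 x)‖ := by
          gcongr
          exacts [inv_pi_le_one, Complex.abs_re_le_norm _]
      _ ≤ 1 * (‖twelfthRoot‖ * (‖cubeRoot‖ * M)) := by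
          rw [norm_mul, norm_mul]; gcongr; exact norm_airyMoment_cubeRoot_le 1 hx0
      _ = 0 + ‖twelfthRoot‖ * ‖cubeRoot‖ * M := by ring
      _ ≤ _ := by gcongr; positivity

/-- Laplace's method with `s = √x`: for `r ≥ 0` the exponent `-r³/3 + s²r` is at most `(2/3)s³ -
(2/3)s(r - s)²`, and the Gaussian is integrated over the whole line. -/
theorem norm_airyMoment_one_le {x : ℝ} (hx : 0 < x) :
    ‖airyMoment 1 0 x‖ ≤
      Real.exp (2 / 3 * x ^ (3 / 2 : ℝ)) * Real.sqrt (Real.pi / (2 / 3 * Real.sqrt x)) := by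
  refine (norm_airyMoment_le _ _ _).trans ?_
  have hs : 0 < Real.sqrt x := Real.sqrt_pos.2 hx
  have hss : Real.sqrt x ^ 2 = x := Real.sq_sqrt hx.le
  have hx3 : x ^ (3 / 2 : ℝ) = Real.sqrt x ^ 3 := by
    rw [Real.sqrt_eq_rpow, ← Real.rpow_natCast, ← Real.rpow_mul hx.le]; norm_num
  have hgi : Integrable fun r : ℝ => Real.exp (-(2 / 3 * Real.sqrt x) * r ^ 2) :=
    integrable_exp_neg_mul_sq (by positivity)
  have hgi' := (hgi.comp_sub_right (Real.sqrt x)).const_mul (Real.exp (2 / 3 * x ^ (3 / 2 : ℝ)))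
  rw [← integral_gaussian,
    ← integral_sub_right_eq_self (fun r => Real.exp (-(2 / 3 * Real.sqrt x) * r ^ 2)) (Real.sqrt x),
    ← integral_const_mul]
  refine le_trans (setIntegral_mono_on (integrableOn_pow_mul_exp_neg_cube 0 _)
    hgi'.integrableOn measurableSet_Ioi fun r (hr : 0 < r) => ?_)
    (setIntegral_le_integral hgi' (ae_of_all _ fun r => by positivity))
  rw [pow_zero, one_mul, ← Real.exp_add, hx3]
  refine Real.exp_le_exp.2 ?_
  rw [Complex.one_re, one_mul]
  generalize Real.sqrt x = s at hs hss
  subst hss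
  nlinarith [mul_nonneg (sq_nonneg (r - s)) hr.le]

/-- The Gaussian width contributes a factor of order `x^{-1/4}`; the oscillating moment is bounded
and so negligible against `e^{ζ}`. -/
theorem Bi_isLittleO {ε : ℝ} (hε : 0 < ε) :
    ∀ᶠ x in atTop, |Bi x| ≤ ε * Real.exp (2 / 3 * x ^ (3 / 2 : ℝ)) := by
  set M := ∫ r in Ioi (0 : ℝ), r ^ 0 * Real.exp (-r ^ 3 / 3 + 0 * r) with hM
  have h1 : ∀ᶠ x : ℝ in atTop, ‖twelfthRoot‖ * M / (ε / 2) ≤ Real.exp (2 / 3 * x ^ (3 / 2 : ℝ)) :=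
    (Real.tendsto_exp_atTop.comp tendsto_zeta).eventually_ge_atTop _
  have h2 : ∀ᶠ x : ℝ in atTop, Real.pi / (2 / 3 * (ε / 2) ^ 2) ≤ Real.sqrt x :=
    Real.tendsto_sqrt_atTop.eventually_ge_atTop _
  filter_upwards [h1, h2, eventually_gt_atTop 0] with x h1 h2 hx
  have hs : 0 < Real.sqrt x := Real.sqrt_pos.2 hx
  rw [Bi_eq, abs_mul, abs_of_pos (by positivity : 0 < Real.pi⁻¹)]
  rw [div_le_iff₀ (by positivity)] at h1
  have h3 : Real.sqrt (Real.pi / (2 / 3 * Real.sqrt x)) ≤ ε / 2 := by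
    rw [Real.sqrt_le_left (by positivity), div_le_iff₀ (by positivity)]
    rw [div_le_iff₀ (by positivity)] at h2
    linarith
  calc _ ≤ 1 * (|(airyMoment 1 0 x).re| + |(twelfthRoot * airyMoment cubeRoot 0 x).im|) := by
        gcongr
        exacts [inv_pi_le_one, abs_add_le _ _]
    _ ≤ 1 * (‖airyMoment 1 0 x‖ + ‖twelfthRoot * airyMoment cubeRoot 0 x‖) := by
        gcongr
        exacts [Complex.abs_re_le_norm _, Complex.abs_im_le_norm _]
    _ ≤ 1 * (Real.exp (2 / 3 * x ^ (3 / 2 : ℝ)) * (ε / 2) + ‖twelfthRoot‖ * M) := by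
        rw [norm_mul]
        gcongr
        · refine (norm_airyMoment_one_le hx).trans ?_
          gcongr
        · exact norm_airyMoment_cubeRoot_le 0 hx.le
    _ ≤ _ := by linarith

theorem deriv_Ai_eventually_lt : ∀ᶠ x in atTop,
    |deriv Ai x| < Real.exp (-(2 / 3 * x ^ (3 / 2 : ℝ))) * Real.sqrt x := by
  obtain ⟨X, hX⟩ := eventually_atTop.1
    ((Ai_isLittleO (ε := 1 / 4) (by norm_num)).and (eventually_ge_atTop 1))
  have hX1 : 1 ≤ X := (hX X le_rfl).2
  filter_upwards [eventually_ge_atTop X] with x hx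
  have hx1 := hX1.trans hx
  have h := abs_le_of_abs_deriv_le_exp (K := 1 / 4) (ε := 1 / 4) hX1 (by norm_num)
    (fun x _ => hasDerivAt_Ai x) (fun x _ => hasDerivAt_deriv_Ai x) (fun x hx => ?_)
    (fun x hx => ?_) hx
  · have : 0 < Real.exp (-(2 / 3 * x ^ (3 / 2 : ℝ))) * Real.sqrt x := by positivity
    linarith
  · rw [abs_mul, abs_of_nonneg (by linarith [(hX x hx).2])]
    have := mul_le_mul_of_nonneg_left (hX x hx).1 (by linarith [(hX x hx).2] : 0 ≤ x)
    linarith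
  · refine (hX x hx).1.trans ?_
    have h0 : 0 ≤ 2 / 3 * x ^ (3 / 2 : ℝ) := by
      have : 0 ≤ x := by linarith [(hX x hx).2]
      positivity
    have : Real.exp (-(2 / 3 * x ^ (3 / 2 : ℝ))) ≤ 1 := Real.exp_le_one_iff.2 (by linarith)
    linarith

/-- The derivative of `√x e^{ζ}/4` dominates `|x Bi|/1` once `|Bi| ≤ e^{ζ}/4`. Integrating `Bi'' = x
Bi` then bounds `|Bi'|` by this function plus a constant, which `e^{ζ}` eventually absorbs. -/
theorem deriv_Bi_eventually_lt : ∀ᶠ x in atTop,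
    |deriv Bi x| < Real.exp (2 / 3 * x ^ (3 / 2 : ℝ)) * Real.sqrt x := by
  obtain ⟨X, hX⟩ := eventually_atTop.1
    ((Bi_isLittleO (ε := 1 / 4) (by norm_num)).and (eventually_ge_atTop 1))
  have hX1 : 1 ≤ X := (hX X le_rfl).2
  have hk : ∀ x, X ≤ x → HasDerivAt (fun x => 1 / 4 *
      (Real.sqrt x * Real.exp (2 / 3 * x ^ (3 / 2 : ℝ))))
      (1 / 4 * ((1 / (2 * Real.sqrt x) + x) * Real.exp (2 / 3 * x ^ (3 / 2 : ℝ)))) x := by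
    intro x hx
    have hx0 : 0 < x := by linarith
    convert! ((Real.hasDerivAt_sqrt hx0.ne').mul (hasDerivAt_zeta hx0).exp).const_mul (1 / 4) using 1
    have := Real.mul_self_sqrt hx0.le
    linear_combination -(1 / 4) * (Real.exp (2 / 3 * x ^ (3 / 2 : ℝ))) * this
  have hb : ∀ x, X ≤ x → |x * Bi x| ≤
      1 / 4 * ((1 / (2 * Real.sqrt x) + x) * Real.exp (2 / 3 * x ^ (3 / 2 : ℝ))) := by
    intro x hx
    have hx0 : 0 < x := by linarith
    rw [abs_mul, abs_of_pos hx0]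
    have h1 := mul_le_mul_of_nonneg_left (hX x hx).1 hx0.le
    have h2 : 0 ≤ 1 / (2 * Real.sqrt x) * Real.exp (2 / 3 * x ^ (3 / 2 : ℝ)) := by positivity
    nlinarith
  have a1 := antitoneOn_Ici_of_hasDerivAt (fun x hx => (hasDerivAt_deriv_Bi x).sub (hk x hx))
    (fun x hx => by linarith [(abs_le.1 (hb x hx)).2])
  have a2 := monotoneOn_Ici_of_hasDerivAt (fun x hx => (hasDerivAt_deriv_Bi x).add (hk x hx))
    (fun x hx => by linarith [(abs_le.1 (hb x hx)).1])
  set K := 1 / 4 * (Real.sqrt X * Real.exp (2 / 3 * X ^ (3 / 2 : ℝ))) + |deriv Bi X| + 1 with hK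
  have hlarge : ∀ᶠ x : ℝ in atTop, 4 * K ≤ Real.exp (2 / 3 * x ^ (3 / 2 : ℝ)) :=
    (Real.tendsto_exp_atTop.comp tendsto_zeta).eventually_ge_atTop _
  filter_upwards [eventually_ge_atTop X, hlarge] with x hx hl
  have b1 := a1 self_mem_Ici hx hx
  have b2 := a2 self_mem_Ici hx hx
  simp only [Pi.sub_apply, Pi.add_apply] at b1 b2
  have hs := one_le_sqrt_self (hX1.trans hx)
  have he := Real.exp_pos (2 / 3 * x ^ (3 / 2 : ℝ))
  have hse : Real.exp (2 / 3 * x ^ (3 / 2 : ℝ)) ≤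
      Real.sqrt x * Real.exp (2 / 3 * x ^ (3 / 2 : ℝ)) := le_mul_of_one_le_left he.le hs
  have hXX : 0 ≤ Real.sqrt X * Real.exp (2 / 3 * X ^ (3 / 2 : ℝ)) := by positivity
  have d1 := le_abs_self (deriv Bi X)
  have d2 := neg_abs_le (deriv Bi X)
  rw [abs_lt]
  constructor <;> linarith

theorem exists_threshold {u : ℝ → ℝ} (hu : IsHastingsMcLeod u) : ∃ T : ℝ, IsThreshold u T := by
  -- With `1/20`, eventually `|u| ≤ 2|Ai| ≤ e^{-ζ}/10`. Then `|u''| ≤ 3x|u| ≤ (3/10) x e^{-ζ}`, and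
  -- the derivative lemma doubles `3/10` to `3/5 < 1`.
  have hAi := Ai_isLittleO (ε := 1 / 20) (by norm_num)
  have huAi : ∀ᶠ x in atTop, |u x - Ai x| ≤ 1 * |Ai x| := by
    simpa using hu.asymp.isLittleO.bound one_pos
  have hu1 : ∀ᶠ x in atTop, |u x| ≤ 1 / 10 * Real.exp (-(2 / 3 * x ^ (3 / 2 : ℝ))) := by
    filter_upwards [hAi, huAi] with x h1 h2
    have := abs_sub_abs_le_abs_sub (u x) (Ai x)
    linarith
  have hu2 : ∀ᶠ x in atTop,
      |deriv u x| < Real.exp (-(2 / 3 * x ^ (3 / 2 : ℝ))) * Real.sqrt x := by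
    obtain ⟨X, hX⟩ := eventually_atTop.1 (hu1.and (eventually_ge_atTop 1))
    have hX1 : 1 ≤ X := (hX X le_rfl).2
    have hU : ∀ x, X ≤ x → |u x| ≤ 1 := by
      intro x hx
      refine (hX x hx).1.trans ?_
      have h0 : 0 ≤ 2 / 3 * x ^ (3 / 2 : ℝ) := by
        have : 0 ≤ x := by linarith [(hX x hx).2]
        positivity
      have : Real.exp (-(2 / 3 * x ^ (3 / 2 : ℝ))) ≤ 1 := Real.exp_le_one_iff.2 (by linarith)
      linarith
    filter_upwards [eventually_ge_atTop X] with x hx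
    have hx1 := hX1.trans hx
    have h := abs_le_of_abs_deriv_le_exp (K := 1) (ε := 3 / 10) hX1 (by norm_num)
      (fun x _ => (hu.differentiable x).hasDerivAt) (fun x _ => hu.painleve x) (fun x hx => ?_)
      hU hx
    · have : 0 < Real.exp (-(2 / 3 * x ^ (3 / 2 : ℝ))) * Real.sqrt x := by positivity
      linarith
    · have hx1 := (hX x hx).2
      have h1 := hU x hx
      have h2 : |2 * u x ^ 3| ≤ 2 * |u x| := by
        rw [abs_mul, abs_pow, abs_two]
        have : |u x| ^ 3 ≤ |u x| := pow_le_of_le_one (abs_nonneg _) h1 (by norm_num)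
        linarith
      calc |x * u x + 2 * u x ^ 3| ≤ |x * u x| + |2 * u x ^ 3| := abs_add_le _ _
        _ ≤ x * |u x| + 2 * |u x| := by
          rw [abs_mul, abs_of_nonneg (by linarith)]; linarith
        _ ≤ 3 * x * |u x| := by nlinarith [abs_nonneg (u x)]
        _ ≤ 3 * x * (1 / 10 * Real.exp (-(2 / 3 * x ^ (3 / 2 : ℝ)))) := by
          gcongr; exact (hX x hx).1
        _ = _ := by ring
  obtain ⟨X, hX⟩ := eventually_atTop.1 ((((hAi.and deriv_Ai_eventually_lt).and
    ((Bi_isLittleO (ε := 1 / 2) (by norm_num)).and deriv_Bi_eventually_lt)).and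
    (hu1.and hu2)).and (eventually_ge_atTop 1))
  have hX1 : 1 ≤ X := (hX X le_rfl).2
  have h3 : (1 : ℝ) ≤ 3 ^ (2 / 3 : ℝ) := Real.one_le_rpow (by norm_num) (by norm_num)
  have hXX : X ≤ X * 3 ^ (2 / 3 : ℝ) := le_mul_of_one_le_right (by linarith) h3
  have hdiv : X * 3 ^ (2 / 3 : ℝ) / 3 ^ (2 / 3 : ℝ) = X := by
    field_simp
  -- The factor `3^{2/3}` is removed again by the rescaling in the Airy bounds; since it is at least
  -- `1`, the bounds on `u` persist.
  refine ⟨X * 3 ^ (2 / 3 : ℝ), hX1.trans hXX, fun x hx => ?_, fun x hx => ?_, fun x hx => ?_⟩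
  · rw [hdiv] at hx
    obtain ⟨⟨⟨-, h1, h2⟩, -⟩, -⟩ := hX x hx
    exact ⟨h1.trans_lt (by linarith [Real.exp_pos (2 / 3 * x ^ (3 / 2 : ℝ))]), h2⟩
  · rw [hdiv] at hx
    obtain ⟨⟨⟨⟨h1, h2⟩, -⟩, -⟩, -⟩ := hX x hx
    exact ⟨h1.trans_lt (by linarith [Real.exp_pos (-(2 / 3 * x ^ (3 / 2 : ℝ)))]), h2⟩
  · obtain ⟨⟨-, h1, h2⟩, -⟩ := hX x (hXX.trans hx)
    exact ⟨h1.trans_lt (by linarith [Real.exp_pos (-(2 / 3 * x ^ (3 / 2 : ℝ)))]), h2⟩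

end AiryBounds

end AiryPicard

namespace AiryPicard

/-! ### Exponentials of `t^{3/2}` and their exact integrals. -/

section Exponential

open Set

/-- The exponential `exp (-a t^{3/2})`. -/
noncomputable def expDecay (a t : ℝ) : ℝ := Real.exp (-a * t ^ (3 / 2 : ℝ))

theorem expDecay_pos (a t : ℝ) : 0 < expDecay a t := Real.exp_pos _

theorem expDecay_mul (a b t : ℝ) : expDecay a t * expDecay b t = expDecay (a + b) t := by
  rw [expDecay, expDecay, expDecay, ← Real.exp_add]; ring_nf

theorem expDecay_zero (t : ℝ) : expDecay 0 t = 1 := by simp [expDecay]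

theorem expDecay_anti {a b t : ℝ} (hab : a ≤ b) (ht : 0 ≤ t) : expDecay b t ≤ expDecay a t := by
  refine Real.exp_le_exp.2 ?_
  have : 0 ≤ t ^ (3 / 2 : ℝ) := by positivity
  nlinarith

theorem hasDerivAt_expDecay (a : ℝ) {t : ℝ} (ht : 0 < t) :
    HasDerivAt (expDecay a) (-(3 / 2 * a) * (Real.sqrt t * expDecay a t)) t := by
  have h := ((hasDerivAt_zeta ht).const_mul (-(3 / 2 * a))).exp
  have e : (fun x : ℝ => Real.exp (-(3 / 2 * a) * (2 / 3 * x ^ (3 / 2 : ℝ)))) = expDecay a := by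
    funext x; rw [expDecay]; ring_nf
  rw [e] at h
  convert! h using 1
  rw [← congrFun e t]; ring

theorem tendsto_expDecay {a : ℝ} (ha : 0 < a) : Tendsto (expDecay a) atTop (𝓝 0) := by
  have h : Tendsto (fun x : ℝ => a * x ^ (3 / 2 : ℝ)) atTop atTop :=
    (tendsto_rpow_atTop (by norm_num)).const_mul_atTop ha
  refine (Real.tendsto_exp_neg_atTop_nhds_zero.comp h).congr fun x => ?_
  simp [expDecay]

theorem integrableOn_sqrt_mul_expDecay {a t : ℝ} (ha : 0 < a) (ht : 0 < t) :
    IntegrableOn (fun s => Real.sqrt s * expDecay a s) (Ioi t) := by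
  refine integrableOn_Ioi_deriv_of_nonneg' (g := fun s => -(2 / 3 / a) * expDecay a s) (l := 0)
    (fun x (hx : t ≤ x) => ?_) (fun x _ => mul_nonneg (Real.sqrt_nonneg _) (expDecay_pos _ _).le)
    (by simpa using (tendsto_expDecay ha).const_mul (-(2 / 3 / a)))
  convert! (hasDerivAt_expDecay a (ht.trans_le hx)).const_mul (-(2 / 3 / a)) using 1
  field_simp

/-- The factor `√s` makes the integrand an exact derivative. Every denominator in the constants of
the iteration comes from the factor `(2/3)/a`. -/
theorem integral_sqrt_mul_expDecay {a t : ℝ} (ha : 0 < a) (ht : 0 < t) :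
    ∫ s in Ioi t, Real.sqrt s * expDecay a s = 2 / 3 / a * expDecay a t := by
  rw [integral_Ioi_of_hasDerivAt_of_tendsto' (f := fun s => -(2 / 3 / a) * expDecay a s) (m := 0)
    (fun x (hx : t ≤ x) => ?_) (integrableOn_sqrt_mul_expDecay ha ht)
    (by simpa using (tendsto_expDecay ha).const_mul (-(2 / 3 / a)))]
  · ring
  · convert! (hasDerivAt_expDecay a (ht.trans_le hx)).const_mul (-(2 / 3 / a)) using 1
    field_simp

end Exponential

/-! ### Integrals from infinity: bounds, derivative, limits. -/

section ImproperIntegrals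

open Set

theorem integrableOn_of_le_sqrt_mul_expDecay {f : ℝ → ℝ} {T b c : ℝ} (hT : 0 < T) (hb : 0 < b)
    (hf : AEStronglyMeasurable f (volume.restrict (Ioi T)))
    (h : ∀ s, T ≤ s → |f s| ≤ c * (Real.sqrt s * expDecay b s)) : IntegrableOn f (Ioi T) :=
  Integrable.mono' ((integrableOn_sqrt_mul_expDecay hb hT).const_mul c) hf
    ((ae_restrict_iff' measurableSet_Ioi).2 (ae_of_all _ fun s (hs : T < s) => h s hs.le))

theorem abs_intFromInfty_le {f : ℝ → ℝ} {T b c t : ℝ} (hT : 0 < T) (hb : 0 < b)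
    (hf : AEStronglyMeasurable f (volume.restrict (Ioi T)))
    (h : ∀ s, T ≤ s → |f s| ≤ c * (Real.sqrt s * expDecay b s)) (ht : T ≤ t) :
    |intFromInfty f t| ≤ c * (2 / 3 / b) * expDecay b t := by
  have hi := (integrableOn_of_le_sqrt_mul_expDecay hT hb hf h).mono_set (Ioi_subset_Ioi ht)
  rw [intFromInfty, abs_neg]
  calc |∫ s in Ioi t, f s| ≤ ∫ s in Ioi t, |f s| := abs_integral_le_integral_abs
    _ ≤ ∫ s in Ioi t, c * (Real.sqrt s * expDecay b s) :=
      setIntegral_mono_on hi.abs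
        ((integrableOn_sqrt_mul_expDecay hb (hT.trans_le ht)).const_mul c) measurableSet_Ioi
        fun s (hs : t < s) => h s (ht.trans hs.le)
    _ = _ := by
      rw [integral_const_mul, integral_sqrt_mul_expDecay hb (hT.trans_le ht)]; ring

/-- Strictness survives integration because the gap is positive at every point of a set of positive
measure. -/
theorem abs_intFromInfty_lt {f : ℝ → ℝ} {T b c t : ℝ} (hT : 0 < T) (hb : 0 < b)
    (hf : AEStronglyMeasurable f (volume.restrict (Ioi T)))
    (h : ∀ s, T ≤ s → |f s| < c * (Real.sqrt s * expDecay b s)) (ht : T ≤ t) :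
    |intFromInfty f t| < c * (2 / 3 / b) * expDecay b t := by
  have hi := (integrableOn_of_le_sqrt_mul_expDecay hT hb hf fun s hs => (h s hs).le).mono_set
    (Ioi_subset_Ioi ht)
  have hg := (integrableOn_sqrt_mul_expDecay hb (hT.trans_le ht)).const_mul c
  have hpos : 0 < ∫ s in Ioi t, (c * (Real.sqrt s * expDecay b s) - |f s|) := by
    rw [setIntegral_pos_iff_support_of_nonneg_ae]
    · have : Function.support (fun s => c * (Real.sqrt s * expDecay b s) - |f s|) ∩ Ioi t =
          Ioi t := by
        refine inter_eq_right.2 fun s (hs : t < s) => ?_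
        exact (sub_pos.2 (h s (ht.trans hs.le))).ne'
      rw [this]; simp
    · exact (ae_restrict_iff' measurableSet_Ioi).2 (ae_of_all _ fun s (hs : t < s) =>
        (sub_pos.2 (h s (ht.trans hs.le))).le)
    · exact hg.sub hi.abs
  rw [integral_sub hg hi.abs, integral_const_mul,
    integral_sqrt_mul_expDecay hb (hT.trans_le ht)] at hpos
  rw [intFromInfty, abs_neg]
  calc |∫ s in Ioi t, f s| ≤ ∫ s in Ioi t, |f s| := abs_integral_le_integral_abs
    _ < _ := by linarith

theorem continuousOn_intFromInfty {f : ℝ → ℝ} {T : ℝ} (hf : IntegrableOn f (Ioi T)) :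
    ContinuousOn (intFromInfty f) (Ici T) :=
  hf.continuousOn_Ici_primitive_Ioi.neg

/-- Continuity is given only on `[T, ∞)`. Extending `f` to the left by its value at `T` gives a
continuous function on the line, to which the fundamental theorem of calculus applies, including at
`T`. -/
theorem hasDerivWithinAt_intFromInfty {f : ℝ → ℝ} {T t : ℝ} (hf : IntegrableOn f (Ioi T))
    (hc : ContinuousOn f (Ici T)) (ht : T ≤ t) :
    HasDerivWithinAt (intFromInfty f) (f t) (Ici T) t := by
  have hcont : Continuous fun s => f (max s T) :=
    hc.comp_continuous (by fun_prop) fun s => le_max_right s T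
  have hd : HasDerivAt (fun t => intFromInfty f T + ∫ s in T..t, f (max s T)) (f (max t T)) t :=
    ((hcont.integral_hasStrictDerivAt T t).hasDerivAt).const_add _
  rw [max_eq_left ht] at hd
  have e : ∀ t, T ≤ t → intFromInfty f t = intFromInfty f T + ∫ s in T..t, f (max s T) := by
    intro t ht
    have h := intervalIntegral.integral_Ioi_sub_Ioi hf ht
    have e : ∫ s in T..t, f (max s T) = ∫ s in T..t, f s := by
      refine intervalIntegral.integral_congr fun s hs => ?_
      rw [uIcc_of_le ht] at hs
      simp only [max_eq_left hs.1]
    simp only [intFromInfty] at h ⊢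
    rw [e, ← h]; ring
  exact hd.hasDerivWithinAt.congr (fun s hs => e s hs) (e t ht)

theorem intFromInfty_congr {f g : ℝ → ℝ} {t : ℝ} (h : ∀ s, t ≤ s → f s = g s) :
    intFromInfty f t = intFromInfty g t := by
  rw [intFromInfty, intFromInfty,
    setIntegral_congr_fun measurableSet_Ioi fun s (hs : t < s) => h s hs.le]

theorem intFromInfty_add {f g : ℝ → ℝ} {T t : ℝ} (hf : IntegrableOn f (Ioi T))
    (hg : IntegrableOn g (Ioi T)) (ht : T ≤ t) :
    intFromInfty (fun s => f s + g s) t = intFromInfty f t + intFromInfty g t := by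
  simp only [intFromInfty]
  rw [integral_add (hf.mono_set (Ioi_subset_Ioi ht)) (hg.mono_set (Ioi_subset_Ioi ht))]
  ring

theorem intFromInfty_const_mul (c : ℝ) (f : ℝ → ℝ) (t : ℝ) :
    intFromInfty (fun s => c * f s) t = c * intFromInfty f t := by
  simp only [intFromInfty]
  rw [integral_const_mul]; ring

theorem tendsto_intFromInfty {F : ℕ → ℝ → ℝ} {f : ℝ → ℝ} {T b c t : ℝ} (hT : 0 < T) (hb : 0 < b)
    (hF : ∀ n, AEStronglyMeasurable (F n) (volume.restrict (Ioi T)))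
    (h : ∀ n s, T ≤ s → |F n s| ≤ c * (Real.sqrt s * expDecay b s))
    (hlim : ∀ s, T ≤ s → Tendsto (fun n => F n s) atTop (𝓝 (f s))) (ht : T ≤ t) :
    Tendsto (fun n => intFromInfty (F n) t) atTop (𝓝 (intFromInfty f t)) := by
  refine (tendsto_integral_of_dominated_convergence
    (fun s => c * (Real.sqrt s * expDecay b s))
    (fun n => (hF n).mono_measure (Measure.restrict_mono (Ioi_subset_Ioi ht) le_rfl))
    ((integrableOn_sqrt_mul_expDecay hb (hT.trans_le ht)).const_mul c) (fun n => ?_) ?_).neg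
  · exact (ae_restrict_iff' measurableSet_Ioi).2
      (ae_of_all _ fun s (hs : t < s) => h n s (ht.trans hs.le))
  · exact (ae_restrict_iff' measurableSet_Ioi).2
      (ae_of_all _ fun s (hs : t < s) => hlim s (ht.trans hs.le))

end ImproperIntegrals

/-! ### The threshold bounds in the variable `t`. -/

section Threshold

variable {u : ℝ → ℝ} {T t : ℝ}

/-- The real cube root of `3`. -/
noncomputable def cbrtThree : ℝ := (3 : ℝ) ^ (1 / 3 : ℝ)

theorem cbrtThree_pos : 0 < cbrtThree := by unfold cbrtThree; positivity

theorem cbrtThree_pow : cbrtThree ^ 3 = 3 := by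
  rw [cbrtThree, ← Real.rpow_natCast, ← Real.rpow_mul (by norm_num)]; norm_num

theorem three_rpow_two_thirds : (3 : ℝ) ^ (2 / 3 : ℝ) = cbrtThree ^ 2 := by
  rw [cbrtThree, ← Real.rpow_natCast, ← Real.rpow_mul (by norm_num)]; norm_num

theorem sc_eq (t : ℝ) : sc t = t / cbrtThree ^ 2 := by rw [sc, three_rpow_two_thirds]

theorem sqrt_sc (t : ℝ) : Real.sqrt (sc t) = Real.sqrt t / cbrtThree := by
  rw [sc_eq, Real.sqrt_div' _ (by positivity), Real.sqrt_sq cbrtThree_pos.le]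

/-- Since `(3^{2/3})^{3/2} = 3`, the rescaled Airy functions have rate `2/9`, a third of the rate
`2/3` of `u`. This gap makes the integrals against `Bi` converge. -/
theorem zeta_sc (ht : 0 ≤ t) : 2 / 3 * sc t ^ (3 / 2 : ℝ) = 2 / 9 * t ^ (3 / 2 : ℝ) := by
  rw [sc, Real.div_rpow ht (by positivity), ← Real.rpow_mul (by norm_num)]
  norm_num
  ring

theorem IsThreshold.pos (h : IsThreshold u T) : 0 < T := one_pos.trans_le h.one_le

theorem IsThreshold.sc_le (_h : IsThreshold u T) (ht : T ≤ t) :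
    T / (3 : ℝ) ^ (2 / 3 : ℝ) ≤ sc t := by
  unfold sc; gcongr

theorem IsThreshold.abs_Ai_lt (h : IsThreshold u T) (ht : T ≤ t) :
    |Ai (sc t)| < expDecay (2 / 9) t := by
  have := (h.ai _ (h.sc_le ht)).1
  rwa [zeta_sc (h.pos.le.trans ht), ← neg_mul] at this

theorem IsThreshold.abs_deriv_Ai_lt (h : IsThreshold u T) (ht : T ≤ t) :
    |deriv Ai (sc t)| < Real.sqrt t / cbrtThree * expDecay (2 / 9) t := by
  have := (h.ai _ (h.sc_le ht)).2
  rwa [zeta_sc (h.pos.le.trans ht), ← neg_mul, sqrt_sc, mul_comm] at this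

theorem IsThreshold.abs_Bi_lt (h : IsThreshold u T) (ht : T ≤ t) :
    |Bi (sc t)| < expDecay (-(2 / 9)) t := by
  have := (h.bi _ (h.sc_le ht)).1
  rwa [zeta_sc (h.pos.le.trans ht), ← neg_neg (2 / 9 : ℝ)] at this

theorem IsThreshold.abs_deriv_Bi_lt (h : IsThreshold u T) (ht : T ≤ t) :
    |deriv Bi (sc t)| < Real.sqrt t / cbrtThree * expDecay (-(2 / 9)) t := by
  have := (h.bi _ (h.sc_le ht)).2
  rwa [zeta_sc (h.pos.le.trans ht), ← neg_neg (2 / 9 : ℝ), sqrt_sc, mul_comm] at this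

theorem IsThreshold.abs_u_lt (h : IsThreshold u T) (ht : T ≤ t) : |u t| < expDecay (2 / 3) t := by
  have := (h.hm _ ht).1
  rwa [← neg_mul] at this

theorem IsThreshold.abs_deriv_u_lt (h : IsThreshold u T) (ht : T ≤ t) :
    |deriv u t| < Real.sqrt t * expDecay (2 / 3) t := by
  have := (h.hm _ ht).2
  rwa [← neg_mul, mul_comm] at this

theorem continuous_Ai : Continuous Ai :=
  continuous_iff_continuousAt.2 fun x => (hasDerivAt_Ai x).continuousAt

theorem continuous_Bi : Continuous Bi :=
  continuous_iff_continuousAt.2 fun x => (hasDerivAt_Bi x).continuousAt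

theorem continuous_deriv_Ai : Continuous (deriv Ai) :=
  continuous_iff_continuousAt.2 fun x => (hasDerivAt_deriv_Ai x).continuousAt

theorem continuous_deriv_Bi : Continuous (deriv Bi) :=
  continuous_iff_continuousAt.2 fun x => (hasDerivAt_deriv_Bi x).continuousAt

theorem continuous_sc : Continuous sc := by unfold sc; fun_prop

theorem IsHastingsMcLeod.continuous (hu : IsHastingsMcLeod u) : Continuous u :=
  hu.differentiable.continuous

theorem IsHastingsMcLeod.continuous_deriv (hu : IsHastingsMcLeod u) : Continuous (deriv u) :=
  continuous_iff_continuousAt.2 fun x => (hu.painleve x).continuousAt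

end Threshold

end AiryPicard

namespace AiryPicard

/-! ### The recursion and growth of the constants. -/

section Constants

/-- The constants `C_{1k}^{(j)}`, extended to `j = 0` so as to bound the initial iterate. -/
noncomputable def boundOne (k : Fin 3) (j : ℕ) : ℝ := if k = 0 ∧ j = 0 then 0 else C₁ k j

theorem boundOne_succ (k : Fin 3) (j : ℕ) : boundOne k (j + 1) = C₁ k (j + 1) := by
  simp [boundOne]

/-- The common factor `π^j 3^{-j/3}`. -/
noncomputable def prefactor (j : ℕ) : ℝ := Real.pi ^ j * (3 : ℝ) ^ (-(j : ℝ) / 3)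

theorem prefactor_succ (j : ℕ) : prefactor (j + 1) = Real.pi / cbrtThree * prefactor j := by
  have : (3 : ℝ) ^ (-((j + 1 : ℕ) : ℝ) / 3) = (3 : ℝ) ^ (-(j : ℝ) / 3) / cbrtThree := by
    rw [cbrtThree, ← Real.rpow_sub (by norm_num)]
    congr 1
    push_cast
    ring
  rw [prefactor, prefactor, this, pow_succ]
  ring

theorem C₁_zero_eq (j : ℕ) : C₁ 0 j = prefactor j * (3 / ((j - 1).factorial : ℝ) *
    ∏ i ∈ Finset.Icc 1 j, (2 * (i : ℝ) - 1) / (3 * (i : ℝ) - 2)) := rfl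

theorem C₁_one_eq (j : ℕ) : C₁ 1 j = prefactor j *
    ∏ i ∈ Finset.Icc 1 j, (6 * (i : ℝ) - 1) / ((3 * (i : ℝ) - 1) * (3 * (i : ℝ) - 2)) := rfl

theorem C₁_two_eq (j : ℕ) : C₁ 2 j = prefactor j *
    ∏ i ∈ Finset.Icc 1 j, (6 * (i : ℝ) + 1) / (3 * (i : ℝ) * (3 * (i : ℝ) - 1)) := rfl

theorem C₀_zero_eq (j : ℕ) : C₀ 0 j = prefactor j * (1 / (j.factorial : ℝ) *
    ∏ i ∈ Finset.Icc 1 j, (2 * (i : ℝ) - 1) / (3 * (i : ℝ) - 2)) := rfl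

theorem C₀_one_eq (j : ℕ) : C₀ 1 j = prefactor j *
    ∏ i ∈ Finset.Icc 1 j, (6 * (i : ℝ) - 1) / ((3 * (i : ℝ) - 1) * (3 * (i : ℝ) + 1)) := rfl

theorem C₀_two_eq (j : ℕ) : C₀ 2 j = prefactor j *
    (1 / 2 * ∏ i ∈ Finset.Icc 1 j, (6 * (i : ℝ) + 1) / (3 * (i : ℝ) * (3 * (i : ℝ) + 2))) := rfl

theorem C₁_one_succ (j : ℕ) : C₁ 1 (j + 1) = Real.pi / cbrtThree *
    ((6 * j + 5) / ((3 * j + 2) * (3 * j + 1))) * C₁ 1 j := by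
  rw [C₁_one_eq, C₁_one_eq, prefactor_succ, Finset.prod_Icc_succ_top (by omega)]
  push_cast; ring_nf

theorem C₁_two_succ (j : ℕ) : C₁ 2 (j + 1) = Real.pi / cbrtThree *
    ((6 * j + 7) / ((3 * j + 3) * (3 * j + 2))) * C₁ 2 j := by
  rw [C₁_two_eq, C₁_two_eq, prefactor_succ, Finset.prod_Icc_succ_top (by omega)]
  push_cast; ring_nf

theorem C₀_one_succ (j : ℕ) : C₀ 1 (j + 1) = Real.pi / cbrtThree *
    ((6 * j + 5) / ((3 * j + 2) * (3 * j + 4))) * C₀ 1 j := by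
  rw [C₀_one_eq, C₀_one_eq, prefactor_succ, Finset.prod_Icc_succ_top (by omega)]
  push_cast; ring_nf

theorem C₀_two_succ (j : ℕ) : C₀ 2 (j + 1) = Real.pi / cbrtThree *
    ((6 * j + 7) / ((3 * j + 3) * (3 * j + 5))) * C₀ 2 j := by
  rw [C₀_two_eq, C₀_two_eq, prefactor_succ, Finset.prod_Icc_succ_top (by omega)]
  push_cast; ring_nf

theorem C₀_zero_succ (j : ℕ) : C₀ 0 (j + 1) = Real.pi / cbrtThree *
    ((2 * j + 1) / ((j + 1) * (3 * j + 1))) * C₀ 0 j := by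
  rw [C₀_zero_eq, C₀_zero_eq, prefactor_succ, Finset.prod_Icc_succ_top (by omega),
    Nat.factorial_succ]
  have : (j.factorial : ℝ) ≠ 0 := by positivity
  push_cast
  have e : 2 * ((j : ℝ) + 1) - 1 = 2 * j + 1 := by ring
  have e' : 3 * ((j : ℝ) + 1) - 2 = 3 * j + 1 := by ring
  rw [e, e']
  generalize ∏ i ∈ Finset.Icc 1 j, (2 * (i : ℝ) - 1) / (3 * (i : ℝ) - 2) = P
  field_simp

/-- This relation replaces the six product formulas by one recursion in `n = 3j + k`. It forces the
value `0` at `k = j = 0`, where truncated subtraction in `(j - 1)!` would give `C₁ 0 0 = 3`. -/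
theorem boundOne_eq (k : Fin 3) (j : ℕ) :
    boundOne k j = (3 * j + (k : ℕ)) * C₀ k j := by
  fin_cases k
  · cases j with
    | zero => simp [boundOne]
    | succ j =>
      change boundOne 0 (j + 1) = _
      rw [boundOne_succ]
      change _ = (3 * ((j + 1 : ℕ) : ℝ) + ((0 : ℕ) : ℝ)) * C₀ 0 (j + 1)
      rw [C₁_zero_eq, C₀_zero_eq, Nat.factorial_succ, Nat.add_sub_cancel]
      have : (j.factorial : ℝ) ≠ 0 := by positivity
      push_cast
      field_simp
      ring
  · change C₁ 1 j = (3 * j + ((1 : ℕ) : ℝ)) * C₀ 1 j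
    induction j with
    | zero => simp [C₁_one_eq, C₀_one_eq]
    | succ j ih =>
      rw [C₁_one_succ, C₀_one_succ, ih]
      push_cast
      field_simp
      ring
  · change C₁ 2 j = (3 * j + ((2 : ℕ) : ℝ)) * C₀ 2 j
    induction j with
    | zero => simp [C₁_two_eq, C₀_two_eq]; ring
    | succ j ih =>
      rw [C₁_two_succ, C₀_two_succ, ih]
      push_cast
      field_simp
      ring

/-- With `n = 3j + k` the three cases share the ratio `(2n+3)/((n+1)(n+3))`. -/
theorem C₀_succ (k : Fin 3) (j : ℕ) : C₀ k (j + 1) = Real.pi / cbrtThree *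
    ((2 * (3 * j + (k : ℕ)) + 3) /
      ((3 * j + (k : ℕ) + 1) * (3 * j + (k : ℕ) + 3))) * C₀ k j := by
  fin_cases k
  · change C₀ 0 (j + 1) = Real.pi / cbrtThree * ((2 * (3 * j + ((0 : ℕ) : ℝ)) + 3) /
      ((3 * j + ((0 : ℕ) : ℝ) + 1) * (3 * j + ((0 : ℕ) : ℝ) + 3))) * C₀ 0 j
    rw [C₀_zero_succ]
    push_cast
    field_simp
    ring
  · change C₀ 1 (j + 1) = Real.pi / cbrtThree * ((2 * (3 * j + ((1 : ℕ) : ℝ)) + 3) /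
      ((3 * j + ((1 : ℕ) : ℝ) + 1) * (3 * j + ((1 : ℕ) : ℝ) + 3))) * C₀ 1 j
    rw [C₀_one_succ]
    push_cast
    ring_nf
  · change C₀ 2 (j + 1) = Real.pi / cbrtThree * ((2 * (3 * j + ((2 : ℕ) : ℝ)) + 3) /
      ((3 * j + ((2 : ℕ) : ℝ) + 1) * (3 * j + ((2 : ℕ) : ℝ) + 3))) * C₀ 2 j
    rw [C₀_two_succ]
    push_cast
    ring_nf

theorem C₀_pos (k : Fin 3) (j : ℕ) : 0 < C₀ k j := by
  induction j with
  | zero => fin_cases k <;> simp [C₀]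
  | succ j ih =>
    rw [C₀_succ]
    have := cbrtThree_pos
    positivity

theorem boundOne_nonneg (k : Fin 3) (j : ℕ) : 0 ≤ boundOne k j := by
  rw [boundOne_eq]
  have := C₀_pos k j
  positivity

/-- The right side is what one Picard step produces: the source coefficient `(2/3)C₀ + (1/3)C₁`,
integrated against `Bi` and against `Ai` at rates `d - 2/9 = (4/9)(n+1)` and `d + 2/9 = (4/9)(n+2)`,
where `n = 3j + k`. -/
theorem C₁_succ (k : Fin 3) (j : ℕ) : C₁ k (j + 1) =
    2 * Real.pi / cbrtThree * ((2 / 3 * C₀ k j + 1 / 3 * boundOne k j) *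
      (2 / 3 / (4 / 3 * j + 4 / 9 * (k : ℕ) + 2 / 3 - 2 / 9)) +
      (2 / 3 * C₀ k j + 1 / 3 * boundOne k j) *
      (2 / 3 / (4 / 3 * j + 4 / 9 * (k : ℕ) + 2 / 3 + 2 / 9))) := by
  rw [← boundOne_succ, boundOne_eq, C₀_succ, boundOne_eq]
  have e1 : (4 / 3 * j + 4 / 9 * (k : ℕ) + 2 / 3 - 2 / 9 : ℝ) =
      4 / 9 * (3 * j + (k : ℕ) + 1) := by ring
  have e2 : (4 / 3 * j + 4 / 9 * (k : ℕ) + 2 / 3 + 2 / 9 : ℝ) =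
      4 / 9 * (3 * j + (k : ℕ) + 2) := by ring
  rw [e1, e2]
  push_cast
  have e3 : (3 * ((j : ℝ) + 1) + (k : ℕ)) = 3 * j + (k : ℕ) + 3 := by ring
  rw [e3]
  have hn : (0 : ℝ) ≤ 3 * j + (k : ℕ) := by positivity
  generalize (3 * (j : ℝ) + (k : ℕ)) = n at hn
  have := cbrtThree_pos
  field_simp
  ring

theorem pi_div_cbrtThree_lt : Real.pi / cbrtThree < 9 / 4 := by
  have h : (1.44 : ℝ) < cbrtThree :=
    lt_of_pow_lt_pow_left₀ 3 cbrtThree_pos.le (by rw [cbrtThree_pow]; norm_num)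
  rw [div_lt_iff₀ cbrtThree_pos]
  have := Real.pi_lt_d2
  linarith

/-- A crude bound suffices for convergence: `C₀` does not increase from `j = 1` on, and the factor
`3j + k` in `boundOne` is at most `3 · 2^j`. -/
theorem C₀_growth (k : Fin 3) : ∃ M : ℝ, 0 ≤ M ∧
    ∀ j, C₀ k j ≤ M * 2 ^ j ∧ boundOne k j ≤ M * 2 ^ j := by
  have hstep : ∀ j : ℕ, C₀ k (j + 1 + 1) ≤ C₀ k (j + 1) := by
    intro j
    rw [C₀_succ k (j + 1)]
    push_cast
    have hn : (3 : ℝ) ≤ 3 * ((j : ℝ) + 1) + (k : ℕ) := by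
      have : (0 : ℝ) ≤ 3 * j + (k : ℕ) := by positivity
      linarith
    generalize (3 * ((j : ℝ) + 1) + (k : ℕ)) = n at hn
    refine mul_le_of_le_one_left (C₀_pos k (j + 1)).le ?_
    -- The bound `4/9` is the reciprocal of the bound `9/4` on `π/3^{1/3}`, so the ratio of
    -- consecutive constants is at most `1`.
    have h1 : (2 * n + 3) / ((n + 1) * (n + 3)) ≤ 4 / 9 := by
      rw [div_le_div_iff₀ (by positivity) (by norm_num)]
      nlinarith
    have h0 : 0 ≤ (2 * n + 3) / ((n + 1) * (n + 3)) := by positivity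
    nlinarith [pi_div_cbrtThree_lt]
  have p0 := C₀_pos k 0
  have p1 := C₀_pos k 1
  have hle : ∀ j, C₀ k j ≤ C₀ k 0 + C₀ k 1 := by
    intro j
    cases j with
    | zero => linarith
    | succ j =>
      have : C₀ k (j + 1) ≤ C₀ k 1 := by
        induction j with
        | zero => exact le_rfl
        | succ j ih => exact (hstep j).trans ih
      linarith
  refine ⟨3 * (C₀ k 0 + C₀ k 1), by linarith, fun j => ?_⟩
  have hj : (j : ℝ) + 1 ≤ 2 ^ j := by exact_mod_cast Nat.succ_le_of_lt j.lt_two_pow_self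
  have hk : ((k : ℕ) : ℝ) ≤ 3 := by exact_mod_cast k.isLt.le
  have hj0 : (0 : ℝ) ≤ j := j.cast_nonneg
  constructor
  · nlinarith [hle j]
  · rw [boundOne_eq]
    calc (3 * (j : ℝ) + (k : ℕ)) * C₀ k j ≤ (3 * 2 ^ j) * (C₀ k 0 + C₀ k 1) := by
          refine mul_le_mul (by linarith) (hle j) (C₀_pos k j).le (by positivity)
      _ = _ := by ring

end Constants

end AiryPicard

namespace AiryPicard

/-! ### The linear Picard operators: estimates, continuity, additivity. -/

section Picard

open Set

/-- The homogeneous part of `rhsOne`. -/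
noncomputable def picardOne (u : ℝ → ℝ) (φ : Fin 3 → ℝ → ℝ) (t : ℝ) : ℝ :=
  2 * Real.pi / (3 : ℝ) ^ (1 / 3 : ℝ) *
    (Ai (sc t) * intFromInfty (fun s => Bi (sc s) * source u φ s) t -
      Bi (sc t) * intFromInfty (fun s => Ai (sc s) * source u φ s) t)

/-- The homogeneous part of `rhsTwo`. -/
noncomputable def picardTwo (u : ℝ → ℝ) (φ : Fin 3 → ℝ → ℝ) (t : ℝ) : ℝ :=
  -(Real.pi * (deriv Ai (sc t) * intFromInfty (fun s => Bi (sc s) * source u φ s) t -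
      deriv Bi (sc t) * intFromInfty (fun s => Ai (sc s) * source u φ s) t))

/-- The homogeneous part of `rhsZero`. -/
noncomputable def picardZero (u : ℝ → ℝ) (φ₁ φ₂ : ℝ → ℝ) : ℝ → ℝ :=
  intFromInfty (fun s => 1 / 3 * deriv u s * φ₁ s - 2 / 3 * u s * φ₂ s)

/-- The increments of the Picard iteration; the zeroth one is the initial iterate. -/
noncomputable def incr (u : ℝ → ℝ) (k : Fin 3) : ℕ → Fin 3 → ℝ → ℝ
  | 0 => AiryPicard.iterate u k 0
  | j + 1 => ![picardZero u (picardOne u (incr u k j)) (picardTwo u (incr u k j)),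
      picardOne u (incr u k j), picardTwo u (incr u k j)]

variable {u : ℝ → ℝ} {T t : ℝ} {φ ψ : Fin 3 → ℝ → ℝ}

theorem rhsTwo_eq (k : Fin 3) (φ : Fin 3 → ℝ → ℝ) (t : ℝ) :
    rhsTwo u k φ t = -(3 / 2) * deriv (g k) t + picardTwo u φ t := by
  rw [rhsTwo, picardTwo]; ring

/-- One factor `u` adds `2/3` to the rate of `φ₀` and `u²` adds `4/3` to that of `φ₁`; `d` is any
common lower bound for the resulting rates. -/
theorem abs_source_le (h : IsThreshold u T) {a b c₁ c₀ d : ℝ} (ht : T ≤ t)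
    (h1 : |φ 1 t| ≤ c₁ * expDecay a t) (h0 : |φ 0 t| ≤ c₀ * expDecay b t)
    (hc1 : 0 ≤ c₁) (hc0 : 0 ≤ c₀) (hd0 : d ≤ b + 2 / 3) (hd1 : d ≤ a + 4 / 3) :
    |source u φ t| ≤ (2 / 3 * c₀ + 1 / 3 * c₁) * expDecay d t := by
  have hu := (h.abs_u_lt ht).le
  have ht0 := h.pos.le.trans ht
  have e0 : |u t| * |φ 0 t| ≤ c₀ * expDecay d t := by
    calc |u t| * |φ 0 t| ≤ expDecay (2 / 3) t * (c₀ * expDecay b t) :=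
          mul_le_mul hu h0 (abs_nonneg _) (expDecay_pos _ _).le
      _ = c₀ * expDecay (b + 2 / 3) t := by rw [← expDecay_mul]; ring
      _ ≤ _ := mul_le_mul_of_nonneg_left (expDecay_anti hd0 ht0) hc0
  have e1 : |u t| ^ 2 * |φ 1 t| ≤ c₁ * expDecay d t := by
    calc |u t| ^ 2 * |φ 1 t| ≤ expDecay (2 / 3) t ^ 2 * (c₁ * expDecay a t) :=
          mul_le_mul (pow_le_pow_left₀ (abs_nonneg _) hu 2) h1 (abs_nonneg _)
            (sq_nonneg _)
      _ = c₁ * expDecay (a + 4 / 3) t := by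
        rw [show a + 4 / 3 = a + (2 / 3 + 2 / 3) by ring, ← expDecay_mul, ← expDecay_mul]; ring
      _ ≤ _ := mul_le_mul_of_nonneg_left (expDecay_anti hd1 ht0) hc1
  have : |source u φ t| ≤ 2 / 3 * (|u t| * |φ 0 t|) + 1 / 3 * (|u t| ^ 2 * |φ 1 t|) := by
    unfold source
    refine (abs_sub _ _).trans_eq ?_
    rw [abs_mul, abs_mul, abs_mul, abs_mul, abs_pow, abs_neg, abs_of_pos (by norm_num : (0 : ℝ) < 2 / 3),
      abs_of_pos (by norm_num : (0 : ℝ) < 1 / 3)]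
    ring
  linarith

/-- The factor `√t`, at least `1` because `T ≥ 1`, is inserted only to make the bound exactly
integrable. -/
theorem abs_Ai_mul_le (h : IsThreshold u T) {c d y : ℝ} (ht : T ≤ t)
    (hy : |y| ≤ c * expDecay d t) (hc : 0 ≤ c) :
    |Ai (sc t) * y| ≤ c * (Real.sqrt t * expDecay (d + 2 / 9) t) := by
  have hs := one_le_sqrt_self (h.one_le.trans ht)
  rw [abs_mul]
  calc _ ≤ expDecay (2 / 9) t * (c * expDecay d t) :=
        mul_le_mul (h.abs_Ai_lt ht).le hy (abs_nonneg _) (expDecay_pos _ _).le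
    _ = c * (1 * expDecay (d + 2 / 9) t) := by rw [← expDecay_mul]; ring
    _ ≤ _ := mul_le_mul_of_nonneg_left
      (mul_le_mul_of_nonneg_right hs (expDecay_pos _ _).le) hc

theorem abs_Bi_mul_le (h : IsThreshold u T) {c d y : ℝ} (ht : T ≤ t)
    (hy : |y| ≤ c * expDecay d t) (hc : 0 ≤ c) :
    |Bi (sc t) * y| ≤ c * (Real.sqrt t * expDecay (d - 2 / 9) t) := by
  have hs := one_le_sqrt_self (h.one_le.trans ht)
  rw [abs_mul]
  calc _ ≤ expDecay (-(2 / 9)) t * (c * expDecay d t) :=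
        mul_le_mul (h.abs_Bi_lt ht).le hy (abs_nonneg _) (expDecay_pos _ _).le
    _ = c * (1 * expDecay (d - 2 / 9) t) := by rw [sub_eq_add_neg, ← expDecay_mul]; ring
    _ ≤ _ := mul_le_mul_of_nonneg_left
      (mul_le_mul_of_nonneg_right hs (expDecay_pos _ _).le) hc

theorem aestronglyMeasurable_source (hu : IsHastingsMcLeod u)
    (hφ : ∀ i, AEStronglyMeasurable (φ i) (volume.restrict (Ioi T))) :
    AEStronglyMeasurable (source u φ) (volume.restrict (Ioi T)) := by
  have h0 := hφ 0
  have h1 := hφ 1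
  have hc : AEStronglyMeasurable u (volume.restrict (Ioi T)) := hu.continuous.aestronglyMeasurable
  unfold source
  exact ((hc.const_mul _).mul h0).sub (((hc.pow 2).const_mul _).mul h1)

theorem aestronglyMeasurable_Ai_mul {f : ℝ → ℝ}
    (hf : AEStronglyMeasurable f (volume.restrict (Ioi T))) :
    AEStronglyMeasurable (fun s => Ai (sc s) * f s) (volume.restrict (Ioi T)) :=
  (continuous_Ai.comp continuous_sc).aestronglyMeasurable.mul hf

theorem aestronglyMeasurable_Bi_mul {f : ℝ → ℝ}
    (hf : AEStronglyMeasurable f (volume.restrict (Ioi T))) :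
    AEStronglyMeasurable (fun s => Bi (sc s) * f s) (volume.restrict (Ioi T)) :=
  (continuous_Bi.comp continuous_sc).aestronglyMeasurable.mul hf

theorem aestronglyMeasurable_picardZero_integrand (hu : IsHastingsMcLeod u) {φ₁ φ₂ : ℝ → ℝ}
    (h1 : AEStronglyMeasurable φ₁ (volume.restrict (Ioi T)))
    (h2 : AEStronglyMeasurable φ₂ (volume.restrict (Ioi T))) :
    AEStronglyMeasurable (fun s => 1 / 3 * deriv u s * φ₁ s - 2 / 3 * u s * φ₂ s)
      (volume.restrict (Ioi T)) :=
  (((hu.continuous_deriv.aestronglyMeasurable).const_mul _).mul h1).sub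
    (((hu.continuous.aestronglyMeasurable).const_mul _).mul h2)

/-- The halved constant for `φ₂` makes both terms contribute equally: `(1/3)c + (2/3)(c/2) =
(2/3)c`. -/
theorem abs_picardZero_integrand_le (h : IsThreshold u T) {a c x y : ℝ} (ht : T ≤ t)
    (hx : |x| ≤ c * expDecay a t) (hy : |y| ≤ c / 2 * (Real.sqrt t * expDecay a t)) :
    |1 / 3 * deriv u t * x - 2 / 3 * u t * y| ≤
      2 / 3 * c * (Real.sqrt t * expDecay (a + 2 / 3) t) := by
  have e1 : |deriv u t| * |x| ≤ Real.sqrt t * expDecay (2 / 3) t * (c * expDecay a t) :=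
    mul_le_mul (h.abs_deriv_u_lt ht).le hx (abs_nonneg _)
      (mul_nonneg (Real.sqrt_nonneg _) (expDecay_pos _ _).le)
  have e2 : |u t| * |y| ≤ expDecay (2 / 3) t * (c / 2 * (Real.sqrt t * expDecay a t)) :=
    mul_le_mul (h.abs_u_lt ht).le hy (abs_nonneg _) (expDecay_pos _ _).le
  have e3 : |1 / 3 * deriv u t * x - 2 / 3 * u t * y| ≤
      1 / 3 * (|deriv u t| * |x|) + 2 / 3 * (|u t| * |y|) := by
    refine (abs_sub _ _).trans_eq ?_
    rw [abs_mul, abs_mul, abs_mul, abs_mul, abs_of_pos (by norm_num : (0 : ℝ) < 2 / 3),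
      abs_of_pos (by norm_num : (0 : ℝ) < 1 / 3)]
    ring
  rw [← expDecay_mul]
  linarith

theorem abs_picardZero_integrand_lt (h : IsThreshold u T) {a c x y : ℝ} (ht : T ≤ t)
    (hx : |x| < c * expDecay a t) (hy : |y| < c / 2 * (Real.sqrt t * expDecay a t)) :
    |1 / 3 * deriv u t * x - 2 / 3 * u t * y| <
      2 / 3 * c * (Real.sqrt t * expDecay (a + 2 / 3) t) := by
  have hs := one_le_sqrt_self (h.one_le.trans ht)
  have e1 : |deriv u t| * |x| < Real.sqrt t * expDecay (2 / 3) t * (c * expDecay a t) :=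
    mul_lt_mul'' (h.abs_deriv_u_lt ht) hx (abs_nonneg _) (abs_nonneg _)
  have e2 : |u t| * |y| < expDecay (2 / 3) t * (c / 2 * (Real.sqrt t * expDecay a t)) :=
    mul_lt_mul'' (h.abs_u_lt ht) hy (abs_nonneg _) (abs_nonneg _)
  have e3 : |1 / 3 * deriv u t * x - 2 / 3 * u t * y| ≤
      1 / 3 * (|deriv u t| * |x|) + 2 / 3 * (|u t| * |y|) := by
    refine (abs_sub _ _).trans_eq ?_
    rw [abs_mul, abs_mul, abs_mul, abs_mul, abs_of_pos (by norm_num : (0 : ℝ) < 2 / 3),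
      abs_of_pos (by norm_num : (0 : ℝ) < 1 / 3)]
    ring
  rw [← expDecay_mul]
  linarith

/-- The rates `±2/9` of the Airy prefactor and of the integrand cancel, so the source rate `d` is
preserved. Strictness comes from the prefactors; `d > 2/9` is needed for the integral against `Bi`.
-/
theorem abs_picardOne_lt (h : IsThreshold u T) {c d : ℝ} (hc : 0 < c) (hd : 2 / 9 < d)
    (hm : AEStronglyMeasurable (source u φ) (volume.restrict (Ioi T)))
    (hs : ∀ s, T ≤ s → |source u φ s| ≤ c * expDecay d s) (ht : T ≤ t) :
    |picardOne u φ t| < 2 * Real.pi / cbrtThree *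
      (c * (2 / 3 / (d - 2 / 9)) + c * (2 / 3 / (d + 2 / 9))) * expDecay d t := by
  have hB := abs_intFromInfty_le h.pos (by linarith) (aestronglyMeasurable_Bi_mul hm)
    (fun s hs' => abs_Bi_mul_le h hs' (hs s hs') hc.le) ht
  have hA := abs_intFromInfty_le h.pos (by linarith) (aestronglyMeasurable_Ai_mul hm)
    (fun s hs' => abs_Ai_mul_le h hs' (hs s hs') hc.le) ht
  have p1 : 0 < c * (2 / 3 / (d - 2 / 9)) :=
    mul_pos hc (div_pos (by norm_num) (by linarith))
  have p2 : 0 < c * (2 / 3 / (d + 2 / 9)) :=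
    mul_pos hc (div_pos (by norm_num) (by linarith))
  have hpi := Real.pi_pos
  have hct := cbrtThree_pos
  rw [picardOne, ← cbrtThree, abs_mul, abs_of_pos (by positivity : 0 < 2 * Real.pi / cbrtThree),
    mul_assoc]
  refine mul_lt_mul_of_pos_left ?_ (by positivity)
  refine (abs_sub _ _).trans_lt ?_
  rw [abs_mul, abs_mul]
  have b1 := mul_lt_mul_of_lt_of_le_of_nonneg_of_pos (h.abs_Ai_lt ht) hB (abs_nonneg _)
    (mul_pos p1 (expDecay_pos (d - 2 / 9) t))
  have b2 := mul_lt_mul_of_lt_of_le_of_nonneg_of_pos (h.abs_Bi_lt ht) hA (abs_nonneg _)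
    (mul_pos p2 (expDecay_pos (d + 2 / 9) t))
  have e1 : expDecay (2 / 9) t * expDecay (d - 2 / 9) t = expDecay d t := by
    rw [expDecay_mul]; ring_nf
  have e2 : expDecay (-(2 / 9)) t * expDecay (d + 2 / 9) t = expDecay d t := by
    rw [expDecay_mul]; ring_nf
  calc _ < _ := add_lt_add b1 b2
    _ = c * (2 / 3 / (d - 2 / 9)) * (expDecay (2 / 9) t * expDecay (d - 2 / 9) t) +
      c * (2 / 3 / (d + 2 / 9)) * (expDecay (-(2 / 9)) t * expDecay (d + 2 / 9) t) := by ring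
    _ = _ := by rw [e1, e2]; ring

/-- The derivatives of the Airy functions cost `√t/3^{1/3}`, and the prefactor `π` replaces
`2π/3^{1/3}`: hence half the constant and an extra `√t`. -/
theorem abs_picardTwo_lt (h : IsThreshold u T) {c d : ℝ} (hc : 0 < c) (hd : 2 / 9 < d)
    (hm : AEStronglyMeasurable (source u φ) (volume.restrict (Ioi T)))
    (hs : ∀ s, T ≤ s → |source u φ s| ≤ c * expDecay d s) (ht : T ≤ t) :
    |picardTwo u φ t| < (2 * Real.pi / cbrtThree *
      (c * (2 / 3 / (d - 2 / 9)) + c * (2 / 3 / (d + 2 / 9)))) / 2 *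
        (Real.sqrt t * expDecay d t) := by
  have hB := abs_intFromInfty_le h.pos (by linarith) (aestronglyMeasurable_Bi_mul hm)
    (fun s hs' => abs_Bi_mul_le h hs' (hs s hs') hc.le) ht
  have hA := abs_intFromInfty_le h.pos (by linarith) (aestronglyMeasurable_Ai_mul hm)
    (fun s hs' => abs_Ai_mul_le h hs' (hs s hs') hc.le) ht
  have p1 : 0 < c * (2 / 3 / (d - 2 / 9)) :=
    mul_pos hc (div_pos (by norm_num) (by linarith))
  have p2 : 0 < c * (2 / 3 / (d + 2 / 9)) :=
    mul_pos hc (div_pos (by norm_num) (by linarith))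
  have hpi := Real.pi_pos
  have hct := cbrtThree_pos
  rw [picardTwo, abs_neg, abs_mul, abs_of_pos hpi]
  have b1 := mul_lt_mul_of_lt_of_le_of_nonneg_of_pos (h.abs_deriv_Ai_lt ht) hB (abs_nonneg _)
    (mul_pos p1 (expDecay_pos (d - 2 / 9) t))
  have b2 := mul_lt_mul_of_lt_of_le_of_nonneg_of_pos (h.abs_deriv_Bi_lt ht) hA (abs_nonneg _)
    (mul_pos p2 (expDecay_pos (d + 2 / 9) t))
  have e1 : expDecay (2 / 9) t * expDecay (d - 2 / 9) t = expDecay d t := by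
    rw [expDecay_mul]; ring_nf
  have e2 : expDecay (-(2 / 9)) t * expDecay (d + 2 / 9) t = expDecay d t := by
    rw [expDecay_mul]; ring_nf
  calc _ ≤ Real.pi * (|deriv Ai (sc t)| * |intFromInfty (fun s => Bi (sc s) * source u φ s) t| +
        |deriv Bi (sc t)| * |intFromInfty (fun s => Ai (sc s) * source u φ s) t|) := by
        rw [← abs_mul, ← abs_mul]
        exact mul_le_mul_of_nonneg_left (abs_sub _ _) hpi.le
    _ < _ := mul_lt_mul_of_pos_left (add_lt_add b1 b2) hpi
    _ = Real.pi * (Real.sqrt t / cbrtThree) * (c * (2 / 3 / (d - 2 / 9)) *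
        (expDecay (2 / 9) t * expDecay (d - 2 / 9) t) +
      c * (2 / 3 / (d + 2 / 9)) * (expDecay (-(2 / 9)) t * expDecay (d + 2 / 9) t)) := by ring
    _ = _ := by rw [e1, e2]; ring

/-- Weights dominating all iterates: `1`, `exp (2/9 t^{3/2})` and `√t exp (2/9 t^{3/2})`. -/
noncomputable def weight : Fin 3 → ℝ → ℝ :=
  ![fun _ => 1, expDecay (-(2 / 9)), fun t => Real.sqrt t * expDecay (-(2 / 9)) t]

/-- Measurable triples dominated by a multiple of the weights on `[T, ∞)`. -/
structure Tame (T K : ℝ) (φ : Fin 3 → ℝ → ℝ) : Prop where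
  meas : ∀ i, AEStronglyMeasurable (φ i) (volume.restrict (Ioi T))
  bound : ∀ i t, T ≤ t → |φ i t| ≤ K * weight i t

theorem weight_nonneg (i : Fin 3) (t : ℝ) : 0 ≤ weight i t := by
  fin_cases i
  · exact zero_le_one
  · exact (expDecay_pos _ _).le
  · exact mul_nonneg (Real.sqrt_nonneg _) (expDecay_pos _ _).le

theorem Tame.nonneg {K : ℝ} (hφ : Tame T K φ) : 0 ≤ K := by
  have := (abs_nonneg _).trans (hφ.bound 0 T le_rfl)
  simpa [weight] using this

/-- The term `u φ₀` is the slowest, with rate `2/3 > 2/9`; tameness is therefore enough for all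
integrals to converge. -/
theorem Tame.abs_source_le {K : ℝ} (h : IsThreshold u T) (hφ : Tame T K φ) (ht : T ≤ t) :
    |source u φ t| ≤ K * expDecay (2 / 3) t := by
  have := AiryPicard.abs_source_le (d := 2 / 3) (b := 0) h ht (hφ.bound 1 t ht)
    (by rw [expDecay_zero]; exact hφ.bound 0 t ht) hφ.nonneg hφ.nonneg (by norm_num) (by norm_num)
  linarith

theorem Tame.abs_zero_integrand_le {K : ℝ} (h : IsThreshold u T) (hφ : Tame T K φ) (ht : T ≤ t) :
    |1 / 3 * deriv u t * φ 1 t - 2 / 3 * u t * φ 2 t| ≤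
      4 / 3 * K * (Real.sqrt t * expDecay (4 / 9) t) := by
  have h1 := hφ.bound 1 t ht
  have h2 := hφ.bound 2 t ht
  simp only [weight, Matrix.cons_val] at h1 h2
  have hp := mul_nonneg hφ.nonneg (expDecay_pos (-(2 / 9)) t).le
  have := abs_picardZero_integrand_le h (c := 2 * K) (a := -(2 / 9)) ht
    (h1.trans (by linarith)) (h2.trans_eq (by ring))
  refine this.trans_eq ?_
  rw [show (-(2 / 9) + 2 / 3 : ℝ) = 4 / 9 by norm_num]
  ring

theorem Tame.integralsConverge {K : ℝ} (hu : IsHastingsMcLeod u) (h : IsThreshold u T)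
    (hφ : Tame T K φ) : IntegralsConverge u T φ := by
  have hm := aestronglyMeasurable_source hu hφ.meas
  exact ⟨integrableOn_of_le_sqrt_mul_expDecay h.pos (by norm_num) (aestronglyMeasurable_Bi_mul hm)
      (fun s hs => abs_Bi_mul_le h hs (hφ.abs_source_le h hs) hφ.nonneg),
    integrableOn_of_le_sqrt_mul_expDecay h.pos (by norm_num) (aestronglyMeasurable_Ai_mul hm)
      (fun s hs => abs_Ai_mul_le h hs (hφ.abs_source_le h hs) hφ.nonneg),
    integrableOn_of_le_sqrt_mul_expDecay h.pos (by norm_num)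
      (aestronglyMeasurable_picardZero_integrand hu (hφ.meas 1) (hφ.meas 2))
      (fun s hs => hφ.abs_zero_integrand_le h hs)⟩

theorem continuousOn_picardOne (hφ : IntegralsConverge u T φ) :
    ContinuousOn (picardOne u φ) (Ici T) :=
  continuousOn_const.mul
    (((continuous_Ai.comp continuous_sc).continuousOn.mul (continuousOn_intFromInfty hφ.1)).sub
      ((continuous_Bi.comp continuous_sc).continuousOn.mul (continuousOn_intFromInfty hφ.2.1)))

theorem continuousOn_picardTwo (hφ : IntegralsConverge u T φ) :
    ContinuousOn (picardTwo u φ) (Ici T) :=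
  (continuousOn_const.mul
    (((continuous_deriv_Ai.comp continuous_sc).continuousOn.mul
      (continuousOn_intFromInfty hφ.1)).sub
      ((continuous_deriv_Bi.comp continuous_sc).continuousOn.mul
      (continuousOn_intFromInfty hφ.2.1)))).neg

theorem aestronglyMeasurable_of_continuousOn_Ici {f : ℝ → ℝ} (hf : ContinuousOn f (Ici T)) :
    AEStronglyMeasurable f (volume.restrict (Ioi T)) :=
  (hf.mono Ioi_subset_Ici_self).aestronglyMeasurable measurableSet_Ioi

theorem picardOne_add (hφ : IntegralsConverge u T φ) (hψ : IntegralsConverge u T ψ)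
    (ht : T ≤ t) :
    picardOne u (fun i s => φ i s + ψ i s) t = picardOne u φ t + picardOne u ψ t := by
  have hs : ∀ s, source u (fun i s => φ i s + ψ i s) s = source u φ s + source u ψ s := by
    intro s; simp only [source]; ring
  simp only [picardOne, hs, mul_add]
  rw [intFromInfty_add hφ.1 hψ.1 ht, intFromInfty_add hφ.2.1 hψ.2.1 ht]
  ring

theorem picardTwo_add (hφ : IntegralsConverge u T φ) (hψ : IntegralsConverge u T ψ)
    (ht : T ≤ t) :
    picardTwo u (fun i s => φ i s + ψ i s) t = picardTwo u φ t + picardTwo u ψ t := by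
  have hs : ∀ s, source u (fun i s => φ i s + ψ i s) s = source u φ s + source u ψ s := by
    intro s; simp only [source]; ring
  simp only [picardTwo, hs, mul_add]
  rw [intFromInfty_add hφ.1 hψ.1 ht, intFromInfty_add hφ.2.1 hψ.2.1 ht]
  ring

theorem picardZero_add {φ₁ φ₂ ψ₁ ψ₂ : ℝ → ℝ}
    (hφ : IntegrableOn (fun s => 1 / 3 * deriv u s * φ₁ s - 2 / 3 * u s * φ₂ s) (Ioi T))
    (hψ : IntegrableOn (fun s => 1 / 3 * deriv u s * ψ₁ s - 2 / 3 * u s * ψ₂ s) (Ioi T))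
    (ht : T ≤ t) :
    picardZero u (fun s => φ₁ s + ψ₁ s) (fun s => φ₂ s + ψ₂ s) t =
      picardZero u φ₁ φ₂ t + picardZero u ψ₁ ψ₂ t := by
  rw [picardZero, picardZero, picardZero, ← intFromInfty_add hφ hψ ht]
  congr 1
  funext s
  ring

theorem picardOne_congr (h : ∀ i s, T ≤ s → φ i s = ψ i s) (ht : T ≤ t) :
    picardOne u φ t = picardOne u ψ t := by
  have hs : ∀ s, t ≤ s → source u φ s = source u ψ s := by
    intro s hs; simp only [source, h _ s (ht.trans hs)]
  rw [picardOne, picardOne, intFromInfty_congr fun s hts => by rw [hs s hts],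
    intFromInfty_congr (f := fun s => Ai (sc s) * source u φ s) fun s hts => by rw [hs s hts]]

theorem picardTwo_congr (h : ∀ i s, T ≤ s → φ i s = ψ i s) (ht : T ≤ t) :
    picardTwo u φ t = picardTwo u ψ t := by
  have hs : ∀ s, t ≤ s → source u φ s = source u ψ s := by
    intro s hs; simp only [source, h _ s (ht.trans hs)]
  rw [picardTwo, picardTwo, intFromInfty_congr fun s hts => by rw [hs s hts],
    intFromInfty_congr (f := fun s => Ai (sc s) * source u φ s) fun s hts => by rw [hs s hts]]

theorem picardZero_congr {φ₁ φ₂ ψ₁ ψ₂ : ℝ → ℝ} (h1 : ∀ s, T ≤ s → φ₁ s = ψ₁ s)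
    (h2 : ∀ s, T ≤ s → φ₂ s = ψ₂ s) (ht : T ≤ t) :
    picardZero u φ₁ φ₂ t = picardZero u ψ₁ ψ₂ t :=
  intFromInfty_congr fun s hs => by rw [h1 s (ht.trans hs), h2 s (ht.trans hs)]

end Picard

end AiryPicard

namespace AiryPicard

/-! ### Bounds on the increments, and the iterates as their partial sums. -/

section Increments

open Set

variable {u : ℝ → ℝ} {T t : ℝ} {φ ψ : Fin 3 → ℝ → ℝ}

theorem hasDerivAt_sc (t : ℝ) : HasDerivAt sc (1 / cbrtThree ^ 2) t := by
  rw [funext sc_eq]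
  exact (hasDerivAt_id t).div_const _

theorem hasDerivAt_g_one (t : ℝ) : HasDerivAt (g 1) (deriv Bi (sc t) * (1 / cbrtThree ^ 2)) t :=
  (hasDerivAt_Bi (sc t)).comp t (hasDerivAt_sc t)

theorem hasDerivAt_g_two (t : ℝ) : HasDerivAt (g 2) (deriv Ai (sc t) * (1 / cbrtThree ^ 2)) t :=
  (hasDerivAt_Ai (sc t)).comp t (hasDerivAt_sc t)

theorem hasDerivAt_g_zero (t : ℝ) : HasDerivAt (g 0) 0 t := hasDerivAt_const t (0 : ℝ)

theorem hasDerivAt_g (k : Fin 3) (t : ℝ) : HasDerivAt (g k) (deriv (g k) t) t := by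
  fin_cases k
  · exact (hasDerivAt_g_zero t).differentiableAt.hasDerivAt
  · exact (hasDerivAt_g_one t).differentiableAt.hasDerivAt
  · exact (hasDerivAt_g_two t).differentiableAt.hasDerivAt

/-- The scaled Airy equation `g'' = t g / 9`. -/
theorem hasDerivAt_deriv_g (k : Fin 3) (t : ℝ) :
    HasDerivAt (deriv (g k)) (t * g k t / 9) t := by
  have hc : cbrtThree ^ 6 = 9 := by
    rw [show cbrtThree ^ 6 = (cbrtThree ^ 3) ^ 2 by ring, cbrtThree_pow]; norm_num
  have hc0 := cbrtThree_pos
  have key : ∀ y : ℝ, sc t * y * (1 / cbrtThree ^ 2) * (1 / cbrtThree ^ 2) = t * y / 9 := by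
    intro y
    rw [sc_eq, ← hc]
    field_simp
  fin_cases k
  · change HasDerivAt (deriv (g 0)) (t * (0 : ℝ) / 9) t
    rw [funext fun t => (hasDerivAt_g_zero t).deriv]
    simpa using hasDerivAt_const t (0 : ℝ)
  · change HasDerivAt (deriv (g 1)) (t * Bi (sc t) / 9) t
    rw [funext fun t => (hasDerivAt_g_one t).deriv, ← key]
    exact ((hasDerivAt_deriv_Bi (sc t)).comp t (hasDerivAt_sc t)).mul_const _
  · change HasDerivAt (deriv (g 2)) (t * Ai (sc t) / 9) t
    rw [funext fun t => (hasDerivAt_g_two t).deriv, ← key]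
    exact ((hasDerivAt_deriv_Ai (sc t)).comp t (hasDerivAt_sc t)).mul_const _

theorem continuous_g (k : Fin 3) : Continuous (g k) :=
  continuous_iff_continuousAt.2 fun t => (hasDerivAt_g k t).continuousAt

theorem continuous_deriv_g (k : Fin 3) : Continuous (deriv (g k)) :=
  continuous_iff_continuousAt.2 fun t => (hasDerivAt_deriv_g k t).continuousAt

/-- The decay rate of the `j`-th increment. -/
noncomputable def rate (k : Fin 3) (j : ℕ) : ℝ := 4 / 3 * j + 4 / 9 * (k : ℕ) - 2 / 3

theorem initial_bounds (h : IsThreshold u T) (k : Fin 3) (ht : T ≤ t) :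
    |incr u k 0 1 t| ≤ boundOne k 0 * expDecay (rate k 0) t ∧
    |incr u k 0 2 t| ≤ boundOne k 0 / 2 * (Real.sqrt t * expDecay (rate k 0) t) := by
  have hct := cbrtThree_pos
  have e1 : incr u k 0 1 t = (1 - delta k) * g k t := rfl
  have e2 : incr u k 0 2 t = -(3 / 2) * (1 - delta k) * deriv (g k) t := rfl
  -- The constant is `(3/2) · 3^{-2/3} · 3^{-1/3} = 1/2`, so the ratio of one half between the
  -- second and first components already holds initially.
  have key : ∀ y E : ℝ, |y| < Real.sqrt t / cbrtThree * E →
      |(-(3 / 2) * (1 - 0) * (y * (1 / cbrtThree ^ 2)) : ℝ)| ≤ 1 / 2 * (Real.sqrt t * E) := by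
    intro y E hy
    have : (-(3 / 2) * (1 - 0) * (y * (1 / cbrtThree ^ 2)) : ℝ) =
        -(3 / 2 / cbrtThree ^ 2) * y := by ring
    rw [this, abs_mul, abs_neg, abs_of_pos (by positivity)]
    calc _ ≤ 3 / 2 / cbrtThree ^ 2 * (Real.sqrt t / cbrtThree * E) :=
          mul_le_mul_of_nonneg_left hy.le (by positivity)
      _ = 3 / 2 / cbrtThree ^ 3 * (Real.sqrt t * E) := by field_simp
      _ = _ := by rw [cbrtThree_pow]; norm_num
  rw [e1, e2]
  fin_cases k
  · simp [delta, boundOne]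
  · have hb : boundOne 1 0 = 1 := by simp [boundOne, C₁]
    have hr : rate 1 0 = -(2 / 9) := by simp [rate]; norm_num
    have hδ : delta 1 = 0 := by simp [delta]
    change |(1 - delta 1) * Bi (sc t)| ≤ boundOne 1 0 * expDecay (rate 1 0) t ∧
      |-(3 / 2) * (1 - delta 1) * deriv (g 1) t| ≤
        boundOne 1 0 / 2 * (Real.sqrt t * expDecay (rate 1 0) t)
    rw [hb, hr, hδ, (hasDerivAt_g_one t).deriv]
    exact ⟨by simpa using (h.abs_Bi_lt ht).le, key _ _ (h.abs_deriv_Bi_lt ht)⟩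
  · have hb : boundOne 2 0 = 1 := by simp [boundOne, C₁]
    have hr : rate 2 0 = 2 / 9 := by simp [rate]; norm_num
    have hδ : delta 2 = 0 := by simp [delta]
    change |(1 - delta 2) * Ai (sc t)| ≤ boundOne 2 0 * expDecay (rate 2 0) t ∧
      |-(3 / 2) * (1 - delta 2) * deriv (g 2) t| ≤
        boundOne 2 0 / 2 * (Real.sqrt t * expDecay (rate 2 0) t)
    rw [hb, hr, hδ, (hasDerivAt_g_two t).deriv]
    exact ⟨by simpa using (h.abs_Ai_lt ht).le, key _ _ (h.abs_deriv_Ai_lt ht)⟩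

theorem rate_add (k : Fin 3) (j : ℕ) : rate k j + 2 / 3 = 4 / 9 * (3 * j + (k : ℕ)) := by
  rw [rate]; ring

/-- Integrating the bound for the third component at rate `(4/9)(3j + k)` divides `C₁` by `3j + k`,
which is the relation defining `C₀`. It fails only when the rate is zero. -/
theorem zero_constant (k : Fin 3) (j : ℕ) (hpos : (0 : ℝ) < 3 * j + (k : ℕ)) :
    2 / 3 * boundOne k j * (2 / 3 / (rate k j + 2 / 3)) = C₀ k j := by
  rw [boundOne_eq, rate_add]
  field_simp
  ring

/-- The bounds satisfied by the `j`-th increment. -/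
structure IncrementBounds (T : ℝ) (k : Fin 3) (j : ℕ) (φ : Fin 3 → ℝ → ℝ) : Prop where
  meas : ∀ i, AEStronglyMeasurable (φ i) (volume.restrict (Ioi T))
  one : ∀ t, T ≤ t → |φ 1 t| ≤ boundOne k j * expDecay (rate k j) t
  two : ∀ t, T ≤ t → |φ 2 t| ≤ boundOne k j / 2 * (Real.sqrt t * expDecay (rate k j) t)
  zero : ∀ t, T ≤ t → |φ 0 t| ≤ C₀ k j * expDecay (rate k j + 2 / 3) t

/-- For `t ≥ 1`, a part `8/9` per step of the rate is traded for the numerical factor `e^{-8/9}`;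
the rest stays within the fixed weights. -/
theorem weight_bound {k : Fin 3} {j : ℕ} (hT : 1 ≤ T) (ht : T ≤ t) :
    boundOne k j * expDecay (rate k j) t ≤
      boundOne k j * (Real.exp (-(8 / 9)) ^ j * expDecay (-(2 / 9)) t) ∧
    expDecay (rate k j + 2 / 3) t ≤ Real.exp (-(8 / 9)) ^ j := by
  have ht1 : 1 ≤ t := hT.trans ht
  have ht0 : 0 ≤ t := by linarith
  have hj : (0 : ℝ) ≤ j := j.cast_nonneg
  have h1 : expDecay (8 / 9 * j) t ≤ Real.exp (-(8 / 9)) ^ j := by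
    rw [← Real.exp_nat_mul, expDecay]
    refine Real.exp_le_exp.2 ?_
    have := Real.one_le_rpow ht1 (by norm_num : (0 : ℝ) ≤ 3 / 2)
    nlinarith
  constructor
  -- Here the rate `-2/3` lies below the `-2/9` of the weight, but the bound itself is zero.
  · by_cases hk : k = 0 ∧ j = 0
    · simp [boundOne, hk]
    · refine mul_le_mul_of_nonneg_left ?_ (boundOne_nonneg k j)
      have hr : 8 / 9 * (j : ℝ) + -(2 / 9) ≤ rate k j := by
        rw [rate]
        by_cases hk0 : k = 0
        · have hj0 : j ≠ 0 := fun hj => hk ⟨hk0, hj⟩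
          have hj1 : (1 : ℝ) ≤ j := by exact_mod_cast Nat.one_le_iff_ne_zero.2 hj0
          have : (0 : ℝ) ≤ (k : ℕ) := (k : ℕ).cast_nonneg
          linarith
        · have : (1 : ℝ) ≤ (k : ℕ) := by
            exact_mod_cast Nat.one_le_iff_ne_zero.2 (fun h => hk0 (Fin.ext h))
          linarith
      calc _ ≤ expDecay (8 / 9 * j + -(2 / 9)) t := expDecay_anti hr ht0
        _ = expDecay (8 / 9 * j) t * expDecay (-(2 / 9)) t := (expDecay_mul _ _ _).symm
        _ ≤ _ := mul_le_mul_of_nonneg_right h1 (expDecay_pos _ _).le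
  · refine (expDecay_anti ?_ ht0).trans h1
    rw [rate_add]
    have : (0 : ℝ) ≤ (k : ℕ) := (k : ℕ).cast_nonneg
    linarith

theorem IncrementBounds.tame {k : Fin 3} {j : ℕ} {M : ℝ} (h : IsThreshold u T)
    (hφ : IncrementBounds T k j φ) (hM0 : C₀ k j ≤ M * 2 ^ j)
    (hM1 : boundOne k j ≤ M * 2 ^ j) : Tame T (M * (2 * Real.exp (-(8 / 9))) ^ j) φ := by
  have hE := (Real.exp_pos (-(8 / 9)))
  have hb := boundOne_nonneg k j
  have hM : 0 ≤ M * 2 ^ j := (C₀_pos k j).le.trans hM0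
  refine ⟨hφ.meas, fun i t ht => ?_⟩
  have hw := weight_bound (k := k) (j := j) h.one_le ht
  have hA : boundOne k j * expDecay (rate k j) t ≤
      M * (2 * Real.exp (-(8 / 9))) ^ j * expDecay (-(2 / 9)) t := by
    refine hw.1.trans ?_
    rw [mul_pow, ← mul_assoc, ← mul_assoc]
    exact mul_le_mul_of_nonneg_right (mul_le_mul_of_nonneg_right hM1 (by positivity))
      (expDecay_pos _ _).le
  fin_cases i
  · refine (hφ.zero t ht).trans ?_
    change _ ≤ M * (2 * Real.exp (-(8 / 9))) ^ j * 1
    rw [mul_one, mul_pow, ← mul_assoc]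
    exact mul_le_mul hM0 hw.2 (expDecay_pos _ _).le hM
  · exact (hφ.one t ht).trans hA
  · refine (hφ.two t ht).trans ?_
    change _ ≤ M * (2 * Real.exp (-(8 / 9))) ^ j * (Real.sqrt t * expDecay (-(2 / 9)) t)
    have hs := Real.sqrt_nonneg t
    have hp := mul_nonneg hs (mul_nonneg hb (expDecay_pos (rate k j) t).le)
    nlinarith [mul_le_mul_of_nonneg_left hA hs]

theorem IncrementBounds.integralsConverge {k : Fin 3} {j : ℕ} (hu : IsHastingsMcLeod u)
    (h : IsThreshold u T) (hφ : IncrementBounds T k j φ) : IntegralsConverge u T φ := by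
  obtain ⟨M, -, hM⟩ := C₀_growth k
  exact (hφ.tame h (hM j).1 (hM j).2).integralsConverge hu h

/-- For `k = 0` the initial triple is `(φ₁, φ₂, φ₀) = (0, 0, 1)`: the third component does not decay
and its integral formula would have rate zero, so it is treated apart. -/
theorem incrementBounds_zero (hu : IsHastingsMcLeod u) (h : IsThreshold u T) (k : Fin 3) :
    IncrementBounds T k 0 (incr u k 0) := by
  have m1 : AEStronglyMeasurable (incr u k 0 1) (volume.restrict (Ioi T)) :=
    ((continuous_g k).aestronglyMeasurable).const_mul _
  have m2 : AEStronglyMeasurable (incr u k 0 2) (volume.restrict (Ioi T)) :=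
    ((continuous_deriv_g k).aestronglyMeasurable).const_mul _
  have b1 := fun t ht => (initial_bounds h k (t := t) ht).1
  have b2 := fun t ht => (initial_bounds h k (t := t) ht).2
  have e : ∀ t, incr u k 0 0 t = delta k + picardZero u (incr u k 0 1) (incr u k 0 2) t :=
    fun t => rfl
  by_cases hk : k = 0
  · subst hk
    have e0 : ∀ t, incr u 0 0 0 t = 1 := by
      intro t
      rw [e, picardZero]
      have h1 : incr u 0 0 1 = fun _ => 0 := by
        funext s; change (1 - delta 0) * g 0 s = 0; simp [delta]
      have h2 : incr u 0 0 2 = fun _ => 0 := by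
        funext s; change -(3 / 2) * (1 - delta 0) * deriv (g 0) s = 0; simp [delta]
      simp [h1, h2, delta, intFromInfty]
    refine ⟨fun i => ?_, b1, b2, fun t ht => ?_⟩
    · fin_cases i
      · change AEStronglyMeasurable (incr u 0 0 0) _
        rw [funext e0]
        exact aestronglyMeasurable_const
      · exact m1
      · exact m2
    · rw [e0, rate_add]
      simp [expDecay_zero, C₀]
  · have hk1 : (1 : ℝ) ≤ (k : ℕ) := by
      exact_mod_cast Nat.one_le_iff_ne_zero.2 (fun h => hk (Fin.ext h))
    have hδ : delta k = 0 := by simp [delta, hk]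
    have hm := aestronglyMeasurable_picardZero_integrand hu m1 m2
    have hle := fun s (hs : T ≤ s) => abs_picardZero_integrand_le h hs (b1 s hs) (b2 s hs)
    have hr : 0 < rate k 0 + 2 / 3 := by rw [rate_add]; push_cast; linarith
    refine ⟨fun i => ?_, b1, b2, fun t ht => ?_⟩
    · fin_cases i
      · refine aestronglyMeasurable_of_continuousOn_Ici ?_
        exact continuousOn_const.add (continuousOn_intFromInfty
          (integrableOn_of_le_sqrt_mul_expDecay h.pos hr hm hle))
      · exact m1
      · exact m2
    · rw [e, hδ, zero_add, ← zero_constant k 0 (by push_cast; linarith)]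
      exact abs_intFromInfty_le h.pos hr hm hle ht

theorem rate_succ (k : Fin 3) (j : ℕ) :
    rate k (j + 1) = 4 / 3 * j + 4 / 9 * (k : ℕ) + 2 / 3 := by
  rw [rate]; push_cast; ring

/-- The induction step. It needs only non-strict bounds at level `j` and returns strict ones,
because the threshold inequalities are strict. -/
theorem incr_succ_lt {k : Fin 3} {j : ℕ} (hu : IsHastingsMcLeod u) (h : IsThreshold u T)
    (hφ : IncrementBounds T k j (incr u k j)) :
    (∀ i, AEStronglyMeasurable (incr u k (j + 1) i) (volume.restrict (Ioi T))) ∧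
    ∀ t, T ≤ t →
      |incr u k (j + 1) 1 t| < boundOne k (j + 1) * expDecay (rate k (j + 1)) t ∧
      |incr u k (j + 1) 2 t| <
        boundOne k (j + 1) / 2 * (Real.sqrt t * expDecay (rate k (j + 1)) t) ∧
      |incr u k (j + 1) 0 t| < C₀ k (j + 1) * expDecay (rate k (j + 1) + 2 / 3) t := by
  have hj : (0 : ℝ) ≤ j := j.cast_nonneg
  have hk : (0 : ℝ) ≤ (k : ℕ) := (k : ℕ).cast_nonneg
  have hC := C₀_pos k j
  have hb := boundOne_nonneg k j
  have hms := aestronglyMeasurable_source hu hφ.meas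
  -- Nothing is lost here: both terms of the source have exactly the rate `rate k j + 4/3 = rate k
  -- (j + 1)`.
  have hs : ∀ s, T ≤ s → |source u (incr u k j) s| ≤
      (2 / 3 * C₀ k j + 1 / 3 * boundOne k j) * expDecay (rate k (j + 1)) s := fun s hs =>
    abs_source_le h hs (hφ.one s hs) (hφ.zero s hs) hb hC.le
      (by rw [rate_succ, rate]; linarith) (by rw [rate_succ, rate]; linarith)
  have hd : 2 / 9 < rate k (j + 1) := by rw [rate_succ]; linarith
  have hc : 0 < 2 / 3 * C₀ k j + 1 / 3 * boundOne k j := by linarith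
  have b1 : ∀ t, T ≤ t →
      |incr u k (j + 1) 1 t| < boundOne k (j + 1) * expDecay (rate k (j + 1)) t := by
    intro t ht
    rw [boundOne_succ, C₁_succ, ← rate_succ]
    exact abs_picardOne_lt h hc hd hms hs ht
  have b2 : ∀ t, T ≤ t → |incr u k (j + 1) 2 t| <
        boundOne k (j + 1) / 2 * (Real.sqrt t * expDecay (rate k (j + 1)) t) := by
    intro t ht
    rw [boundOne_succ, C₁_succ, ← rate_succ]
    exact abs_picardTwo_lt h hc hd hms hs ht
  have hconv := hφ.integralsConverge hu h
  have m1 : AEStronglyMeasurable (incr u k (j + 1) 1) (volume.restrict (Ioi T)) :=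
    aestronglyMeasurable_of_continuousOn_Ici (continuousOn_picardOne hconv)
  have m2 : AEStronglyMeasurable (incr u k (j + 1) 2) (volume.restrict (Ioi T)) :=
    aestronglyMeasurable_of_continuousOn_Ici (continuousOn_picardTwo hconv)
  have hm := aestronglyMeasurable_picardZero_integrand hu m1 m2
  have hlt := fun s (hs : T ≤ s) => abs_picardZero_integrand_lt h hs (b1 s hs) (b2 s hs)
  have hr : 0 < rate k (j + 1) + 2 / 3 := by linarith
  refine ⟨fun i => ?_, fun t ht => ⟨b1 t ht, b2 t ht, ?_⟩⟩
  · fin_cases i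
    · exact aestronglyMeasurable_of_continuousOn_Ici (continuousOn_intFromInfty
        (integrableOn_of_le_sqrt_mul_expDecay h.pos hr hm fun s hs => (hlt s hs).le))
    · exact m1
    · exact m2
  · rw [← zero_constant k (j + 1) (by push_cast; linarith)]
    exact abs_intFromInfty_lt h.pos hr hm hlt ht

theorem incrementBounds (hu : IsHastingsMcLeod u) (h : IsThreshold u T) (k : Fin 3) (j : ℕ) :
    IncrementBounds T k j (incr u k j) := by
  induction j with
  | zero => exact incrementBounds_zero hu h k
  | succ j ih =>
    obtain ⟨hm, hb⟩ := incr_succ_lt hu h ih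
    exact ⟨hm, fun t ht => (hb t ht).1.le, fun t ht => (hb t ht).2.1.le,
      fun t ht => (hb t ht).2.2.le⟩

theorem Tame.add {K L : ℝ} (hφ : Tame T K φ) (hψ : Tame T L ψ) :
    Tame T (K + L) (fun i s => φ i s + ψ i s) :=
  ⟨fun i => (hφ.meas i).add (hψ.meas i), fun i t ht => by
    rw [add_mul]
    exact (abs_add_le _ _).trans (add_le_add (hφ.bound i t ht) (hψ.bound i t ht))⟩

theorem Tame.congr {K : ℝ} (hφ : Tame T K φ) (h : ∀ i t, T ≤ t → ψ i t = φ i t) :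
    Tame T K ψ :=
  ⟨fun i => (hφ.meas i).congr ((ae_restrict_iff' measurableSet_Ioi).2
    (ae_of_all _ fun t (ht : T < t) => (h i t ht.le).symm)), fun i t ht => by
    rw [h i t ht]; exact hφ.bound i t ht⟩

theorem iterate_succ_one (k : Fin 3) (j : ℕ) (t : ℝ) : AiryPicard.iterate u k (j + 1) 1 t =
    g k t + picardOne u (AiryPicard.iterate u k j) t := rfl

theorem iterate_succ_two (k : Fin 3) (j : ℕ) (t : ℝ) : AiryPicard.iterate u k (j + 1) 2 t =
    -(3 / 2) * deriv (g k) t + picardTwo u (AiryPicard.iterate u k j) t :=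
  rhsTwo_eq k _ t

theorem iterate_zero_comp (k : Fin 3) (j : ℕ) (t : ℝ) : AiryPicard.iterate u k j 0 t =
    delta k + picardZero u (AiryPicard.iterate u k j 1) (AiryPicard.iterate u k j 2) t := by
  cases j <;> rfl

theorem incr_succ_zero (k : Fin 3) (j : ℕ) : incr u k (j + 1) 0 =
    picardZero u (incr u k (j + 1) 1) (incr u k (j + 1) 2) := rfl

theorem iterate_succ_of_one_two {k : Fin 3} {j : ℕ}
    (hc : IntegralsConverge u T (AiryPicard.iterate u k j))
    (hi : IntegralsConverge u T (incr u k (j + 1)))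
    (h1 : ∀ t, T ≤ t → AiryPicard.iterate u k (j + 1) 1 t =
      AiryPicard.iterate u k j 1 t + incr u k (j + 1) 1 t)
    (h2 : ∀ t, T ≤ t → AiryPicard.iterate u k (j + 1) 2 t =
      AiryPicard.iterate u k j 2 t + incr u k (j + 1) 2 t) (i : Fin 3) (ht : T ≤ t) :
    AiryPicard.iterate u k (j + 1) i t =
      AiryPicard.iterate u k j i t + incr u k (j + 1) i t := by
  fin_cases i
  · change AiryPicard.iterate u k (j + 1) 0 t =
      AiryPicard.iterate u k j 0 t + incr u k (j + 1) 0 t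
    rw [iterate_zero_comp, iterate_zero_comp, picardZero_congr h1 h2 ht,
      picardZero_add hc.2.2 hi.2.2 ht, incr_succ_zero]
    ring
  · exact h1 t ht
  · exact h2 t ht

theorem exists_tame_incr (hu : IsHastingsMcLeod u) (h : IsThreshold u T) (k : Fin 3) :
    ∃ M : ℝ, 0 ≤ M ∧ ∀ j, Tame T (M * (2 * Real.exp (-(8 / 9))) ^ j) (incr u k j) := by
  obtain ⟨M, hM0, hM⟩ := C₀_growth k
  exact ⟨M, hM0, fun j => (incrementBounds hu h k j).tame h (hM j).1 (hM j).2⟩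

/-- Additivity of the integral operators requires convergence for the iterate and for the increment,
so tameness of consecutive iterates is carried through the induction. -/
theorem iterate_succ_eq_aux (hu : IsHastingsMcLeod u) (h : IsThreshold u T) (k : Fin 3) (j : ℕ) :
    (∃ K, Tame T K (AiryPicard.iterate u k j)) ∧
    (∃ K, Tame T K (AiryPicard.iterate u k (j + 1))) ∧
    ∀ i t, T ≤ t → AiryPicard.iterate u k (j + 1) i t =
      AiryPicard.iterate u k j i t + incr u k (j + 1) i t := by
  obtain ⟨M, -, hM⟩ := exists_tame_incr hu h k
  have hconv := fun j => (hM j).integralsConverge hu h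
  induction j with
  | zero =>
    have h0 : Tame T _ (AiryPicard.iterate u k 0) := hM 0
    -- Because `g 0 = 0`, the factor `1 - δ_k` in the initial iterate is immaterial: its first two
    -- components already equal the inhomogeneous terms.
    have hg : ∀ t, delta k * g k t = 0 := by
      intro t
      by_cases hk : k = 0
      · subst hk; exact mul_zero _
      · simp [delta, hk]
    have hg' : ∀ t, delta k * deriv (g k) t = 0 := by
      intro t
      by_cases hk : k = 0
      · subst hk; rw [(hasDerivAt_g_zero t).deriv, mul_zero]
      · simp [delta, hk]
    have D := fun i t (ht : T ≤ t) => iterate_succ_of_one_two (u := u) (k := k) (j := 0)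
      (h0.integralsConverge hu h) (hconv 1)
      (fun t _ => by
        have e0 : AiryPicard.iterate u k 0 1 t = (1 - delta k) * g k t := rfl
        have e1 : incr u k (0 + 1) 1 t = picardOne u (AiryPicard.iterate u k 0) t := rfl
        rw [iterate_succ_one, e0, e1]
        linarith [hg t])
      (fun t _ => by
        have e0 : AiryPicard.iterate u k 0 2 t = -(3 / 2) * (1 - delta k) * deriv (g k) t := rfl
        have e1 : incr u k (0 + 1) 2 t = picardTwo u (AiryPicard.iterate u k 0) t := rfl
        rw [iterate_succ_two, e0, e1]
        linarith [hg' t]) i ht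
    exact ⟨⟨_, h0⟩, ⟨_, (h0.add (hM 1)).congr D⟩, D⟩
  | succ j ih =>
    obtain ⟨⟨K, hK⟩, ⟨L, hL⟩, hD⟩ := ih
    have D := fun i t (ht : T ≤ t) => iterate_succ_of_one_two (u := u) (k := k) (j := j + 1)
      (hL.integralsConverge hu h) (hconv (j + 2))
      (fun t ht => by
        rw [iterate_succ_one, iterate_succ_one, picardOne_congr hD ht,
          picardOne_add (hK.integralsConverge hu h) (hconv (j + 1)) ht, add_assoc]
        rfl)
      (fun t ht => by
        rw [iterate_succ_two, iterate_succ_two, picardTwo_congr hD ht,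
          picardTwo_add (hK.integralsConverge hu h) (hconv (j + 1)) ht, add_assoc]
        rfl) i ht
    exact ⟨⟨L, hL⟩, ⟨_, (hL.add (hM (j + 2))).congr D⟩, D⟩

theorem iterate_succ_eq (hu : IsHastingsMcLeod u) (h : IsThreshold u T) (k : Fin 3) (j : ℕ)
    (i : Fin 3) (ht : T ≤ t) : AiryPicard.iterate u k (j + 1) i t =
      AiryPicard.iterate u k j i t + incr u k (j + 1) i t :=
  (iterate_succ_eq_aux hu h k j).2.2 i t ht

theorem iterate_eq_sum (hu : IsHastingsMcLeod u) (h : IsThreshold u T) (k : Fin 3) (j : ℕ)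
    (i : Fin 3) (ht : T ≤ t) :
    AiryPicard.iterate u k j i t = ∑ m ∈ Finset.range (j + 1), incr u k m i t := by
  induction j with
  | zero => rw [Finset.sum_range_one]; rfl
  | succ j ih => rw [Finset.sum_range_succ, ← ih, iterate_succ_eq hu h k j i ht]

theorem differenceBounds (hu : IsHastingsMcLeod u) (h : IsThreshold u T) (k : Fin 3) (j : ℕ)
    (ht : T ≤ t) : DifferenceBounds u k j t := by
  have e : ∀ i, AiryPicard.iterate u k (j + 1) i t - AiryPicard.iterate u k j i t =
      incr u k (j + 1) i t := fun i => by rw [iterate_succ_eq hu h k j i ht]; ring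
  obtain ⟨h1, h2, h0⟩ := (incr_succ_lt hu h (incrementBounds hu h k j)).2 t ht
  rw [boundOne_succ, rate_succ] at h1 h2
  rw [rate_succ] at h0
  refine ⟨by rw [e]; exact h1, by rw [e, mul_assoc]; exact h2, ?_⟩
  rw [e, show (4 / 3 * (j : ℝ) + 4 / 9 * ((k : ℕ) : ℝ) + 4 / 3) =
    4 / 3 * (j : ℝ) + 4 / 9 * ((k : ℕ) : ℝ) + 2 / 3 + 2 / 3 by ring]
  exact h0

end Increments

end AiryPicard

namespace AiryPicard

/-! ### Convergence of the iterates and passage to the limit. -/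

section Limit

open Set

variable {u : ℝ → ℝ} {T t : ℝ} {φ ψ : Fin 3 → ℝ → ℝ}

/-- The limit of the Picard iterates. -/
noncomputable def picardLimit (u : ℝ → ℝ) (k i : Fin 3) (t : ℝ) : ℝ := ∑' j, incr u k j i t

theorem two_mul_exp_lt_one : 2 * Real.exp (-(8 / 9)) < 1 := by
  have h : (2 : ℝ) < Real.exp (8 / 9) := by
    rw [← Real.log_lt_iff_lt_exp (by norm_num)]
    have := Real.log_two_lt_d9
    linarith
  rw [Real.exp_neg, ← div_eq_mul_inv, div_lt_one (Real.exp_pos _)]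
  exact h

/-- The increments form a geometric series relative to the weights. The same series bounds all
iterates uniformly, which is the domination needed for the limit under the integral. -/
theorem exists_tame_iterate (hu : IsHastingsMcLeod u) (h : IsThreshold u T) (k : Fin 3) :
    ∃ K : ℝ, (∀ j, Tame T K (AiryPicard.iterate u k j)) ∧
      ∀ i t, T ≤ t → Tendsto (fun j => AiryPicard.iterate u k j i t) atTop
        (𝓝 (picardLimit u k i t)) := by
  obtain ⟨M, hM0, hM⟩ := exists_tame_incr hu h k
  have hq0 : 0 ≤ 2 * Real.exp (-(8 / 9)) := by positivity
  have hq1 := two_mul_exp_lt_one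
  generalize 2 * Real.exp (-(8 / 9)) = q at hM hq0 hq1
  have hsum := summable_geometric_of_lt_one hq0 hq1
  have hb : ∀ i t, T ≤ t → ∀ m, ‖incr u k m i t‖ ≤ M * weight i t * q ^ m := fun i t ht m =>
    ((hM m).bound i t ht).trans_eq (by ring)
  refine ⟨M * (1 - q)⁻¹, fun j => ⟨?_, fun i t ht => ?_⟩, fun i t ht => ?_⟩
  · obtain ⟨⟨K, hK⟩, -⟩ := iterate_succ_eq_aux hu h k j
    exact hK.meas
  · rw [iterate_eq_sum hu h k j i ht]
    have hw := mul_nonneg hM0 (weight_nonneg i t)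
    calc |∑ m ∈ Finset.range (j + 1), incr u k m i t|
        ≤ ∑ m ∈ Finset.range (j + 1), |incr u k m i t| := Finset.abs_sum_le_sum_abs _ _
      _ ≤ ∑ m ∈ Finset.range (j + 1), M * weight i t * q ^ m :=
        Finset.sum_le_sum fun m _ => hb i t ht m
      _ ≤ ∑' m, M * weight i t * q ^ m :=
        (hsum.mul_left _).sum_le_tsum _ fun m _ => by positivity
      _ = _ := by rw [tsum_mul_left, tsum_geometric_of_lt_one hq0 hq1]; ring
  · have hs : Summable fun m => incr u k m i t :=
      Summable.of_norm_bounded (hsum.mul_left _) (hb i t ht)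
    refine ((tendsto_add_atTop_iff_nat 1).2 hs.hasSum.tendsto_sum_nat).congr fun j => ?_
    rw [iterate_eq_sum hu h k j i ht]

theorem Tame.of_tendsto {K : ℝ} {F : ℕ → Fin 3 → ℝ → ℝ} (hF : ∀ n, Tame T K (F n))
    (hlim : ∀ i t, T ≤ t → Tendsto (fun n => F n i t) atTop (𝓝 (φ i t))) : Tame T K φ :=
  ⟨fun i => aestronglyMeasurable_of_tendsto_ae atTop (fun n => (hF n).meas i)
    ((ae_restrict_iff' measurableSet_Ioi).2 (ae_of_all _ fun t (ht : T < t) => hlim i t ht.le)),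
   fun i t ht => le_of_tendsto (hlim i t ht).abs
    (Eventually.of_forall fun n => (hF n).bound i t ht)⟩

theorem tendsto_source {F : ℕ → Fin 3 → ℝ → ℝ}
    (hlim : ∀ i t, T ≤ t → Tendsto (fun n => F n i t) atTop (𝓝 (φ i t))) (ht : T ≤ t) :
    Tendsto (fun n => source u (F n) t) atTop (𝓝 (source u φ t)) :=
  ((hlim 0 t ht).const_mul _).sub ((hlim 1 t ht).const_mul _)

theorem tendsto_Ai_integral {K : ℝ} {F : ℕ → Fin 3 → ℝ → ℝ} (hu : IsHastingsMcLeod u)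
    (h : IsThreshold u T) (hF : ∀ n, Tame T K (F n))
    (hlim : ∀ i t, T ≤ t → Tendsto (fun n => F n i t) atTop (𝓝 (φ i t))) (ht : T ≤ t) :
    Tendsto (fun n => intFromInfty (fun s => Ai (sc s) * source u (F n) s) t) atTop
      (𝓝 (intFromInfty (fun s => Ai (sc s) * source u φ s) t)) :=
  tendsto_intFromInfty h.pos (by norm_num : (0 : ℝ) < 2 / 3 + 2 / 9)
    (fun n => aestronglyMeasurable_Ai_mul (aestronglyMeasurable_source hu (hF n).meas))
    (fun n _ hs => abs_Ai_mul_le h hs ((hF n).abs_source_le h hs) (hF n).nonneg)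
    (fun _ hs => (tendsto_source hlim hs).const_mul _) ht

theorem tendsto_Bi_integral {K : ℝ} {F : ℕ → Fin 3 → ℝ → ℝ} (hu : IsHastingsMcLeod u)
    (h : IsThreshold u T) (hF : ∀ n, Tame T K (F n))
    (hlim : ∀ i t, T ≤ t → Tendsto (fun n => F n i t) atTop (𝓝 (φ i t))) (ht : T ≤ t) :
    Tendsto (fun n => intFromInfty (fun s => Bi (sc s) * source u (F n) s) t) atTop
      (𝓝 (intFromInfty (fun s => Bi (sc s) * source u φ s) t)) :=
  tendsto_intFromInfty h.pos (by norm_num : (0 : ℝ) < 2 / 3 - 2 / 9)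
    (fun n => aestronglyMeasurable_Bi_mul (aestronglyMeasurable_source hu (hF n).meas))
    (fun n _ hs => abs_Bi_mul_le h hs ((hF n).abs_source_le h hs) (hF n).nonneg)
    (fun _ hs => (tendsto_source hlim hs).const_mul _) ht

/-- Dominated convergence in each integral. The first two equations relate consecutive iterates,
while the third holds within a single iterate, hence the index shift only in the former. -/
theorem solvesIntegralEquations (hu : IsHastingsMcLeod u) (h : IsThreshold u T) (k : Fin 3) :
    SolvesIntegralEquations u T k (picardLimit u k) := by
  obtain ⟨K, hK, hlim⟩ := exists_tame_iterate hu h k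
  refine ⟨(Tame.of_tendsto hK hlim).integralsConverge hu h, fun t ht => ⟨?_, ?_, ?_⟩⟩
  · refine tendsto_nhds_unique ((tendsto_add_atTop_iff_nat 1).2 (hlim 1 t ht)) ?_
    exact ((((tendsto_Bi_integral hu h hK hlim ht).const_mul _).sub
      ((tendsto_Ai_integral hu h hK hlim ht).const_mul _)).const_mul _).const_add _
  · refine tendsto_nhds_unique ((tendsto_add_atTop_iff_nat 1).2 (hlim 2 t ht)) ?_
    exact ((((tendsto_Bi_integral hu h hK hlim ht).const_mul _).sub
      ((tendsto_Ai_integral hu h hK hlim ht).const_mul _)).const_mul _).const_sub _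
  · refine tendsto_nhds_unique (hlim 0 t ht) ?_
    simp only [iterate_zero_comp]
    exact (tendsto_intFromInfty h.pos (by norm_num : (0 : ℝ) < 4 / 9)
      (fun n => aestronglyMeasurable_picardZero_integrand hu ((hK n).meas 1) ((hK n).meas 2))
      (fun n _ hs => (hK n).abs_zero_integrand_le h hs)
      (fun s hs => ((hlim 1 s hs).const_mul _).sub ((hlim 2 s hs).const_mul _)) ht).const_add _

end Limit

/-! ### From integral equations to the linear system, and linear independence. -/

section Solution

open Set

variable {u : ℝ → ℝ} {T t : ℝ} {φ ψ : Fin 3 → ℝ → ℝ}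

theorem SolvesIntegralEquations.continuousOn {k : Fin 3}
    (h : SolvesIntegralEquations u T k φ) (i : Fin 3) : ContinuousOn (φ i) (Ici T) := by
  fin_cases i
  · exact (continuousOn_const.add (continuousOn_intFromInfty h.1.2.2)).congr
      fun t ht => (h.2 t ht).2.2
  · exact ((continuous_g k).continuousOn.add (continuousOn_picardOne h.1)).congr
      fun t ht => (h.2 t ht).1
  · exact ((continuous_const.mul (continuous_deriv_g k)).continuousOn.add
      (continuousOn_picardTwo h.1)).congr
      fun t ht => ((h.2 t ht).2.1).trans (rhsTwo_eq k φ t)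

theorem cbrtThree_div (y : ℝ) :
    2 * Real.pi / cbrtThree * (y * (1 / cbrtThree ^ 2)) = 2 / 3 * (Real.pi * y) := by
  have := cbrtThree_pos
  have h3 := cbrtThree_pow
  field_simp
  rw [h3, mul_comm]

/-- Variation of constants: a solution of the integral equations solves the linear system. -/
theorem SolvesIntegralEquations.isSolutionOn {k : Fin 3} (hu : IsHastingsMcLeod u)
    (h : SolvesIntegralEquations u T k φ) : IsSolutionOn u T φ := by
  intro t ht
  have hc := h.continuousOn
  have hcu := hu.continuous.continuousOn (s := Ici T)
  have hcu' := hu.continuous_deriv.continuousOn (s := Ici T)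
  have hcS : ContinuousOn (source u φ) (Ici T) :=
    ((continuousOn_const.mul hcu).mul (hc 0)).sub ((continuousOn_const.mul (hcu.pow 2)).mul (hc 1))
  have dA := hasDerivWithinAt_intFromInfty h.1.2.1
    ((continuous_Ai.comp continuous_sc).continuousOn.mul hcS) ht
  have dB := hasDerivWithinAt_intFromInfty h.1.1
    ((continuous_Bi.comp continuous_sc).continuousOn.mul hcS) ht
  have d0 := hasDerivWithinAt_intFromInfty h.1.2.2
    (((continuousOn_const.mul hcu').mul (hc 1)).sub ((continuousOn_const.mul hcu).mul (hc 2))) ht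
  have dsc := hasDerivAt_sc t
  have a0 := ((hasDerivAt_Ai (sc t)).comp t dsc).hasDerivWithinAt (s := Ici T)
  have b0 := ((hasDerivAt_Bi (sc t)).comp t dsc).hasDerivWithinAt (s := Ici T)
  have a1 := ((hasDerivAt_deriv_Ai (sc t)).comp t dsc).hasDerivWithinAt (s := Ici T)
  have b1 := ((hasDerivAt_deriv_Bi (sc t)).comp t dsc).hasDerivWithinAt (s := Ici T)
  have hW := wronskian (sc t)
  have hpi : Real.pi * Real.pi⁻¹ = 1 := mul_inv_cancel₀ Real.pi_pos.ne'
  have e1 := (h.2 t ht).1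
  have e2 := (h.2 t ht).2.1
  rw [rhsOne, ← cbrtThree] at e1
  rw [rhsTwo] at e2
  have hS : source u φ t = -(2 / 3) * u t * φ 0 t - 1 / 3 * u t ^ 2 * φ 1 t := rfl
  refine ⟨?_, ?_, ?_⟩
  -- The terms from differentiating the integrals are `Ai Bi S - Bi Ai S` and cancel.
  · have := (hasDerivAt_g k t).hasDerivWithinAt.add
      (((a0.mul dB).sub (b0.mul dA)).const_mul (2 * Real.pi / (3 : ℝ) ^ (1 / 3 : ℝ)))
    convert! this.congr (fun s hs => (h.2 s hs).1) (h.2 t ht).1 using 1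
    rw [e2, ← cbrtThree]
    simp only [Function.comp_apply]
    have k1 := cbrtThree_div (deriv Ai (sc t) *
      intFromInfty (fun s => Bi (sc s) * source u φ s) t - deriv Bi (sc t) *
      intFromInfty (fun s => Ai (sc s) * source u φ s) t)
    linear_combination -k1
  · have := ((hasDerivAt_deriv_g k t).hasDerivWithinAt.const_mul (-(3 / 2))).sub
      (((a1.mul dB).sub (b1.mul dA)).const_mul Real.pi)
    convert! this.congr (fun s hs => (h.2 s hs).2.1) (h.2 t ht).2.1 using 1
    simp only [Function.comp_apply]
    have k3 : ∀ y : ℝ, 2 * Real.pi / cbrtThree * y * t / 9 =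
        2 / 3 * (Real.pi * (sc t * y * (1 / cbrtThree ^ 2))) := by
      intro y
      have hp := cbrtThree_pos
      rw [sc_eq, show t / cbrtThree ^ 2 * y * (1 / cbrtThree ^ 2) =
        t * y / (cbrtThree ^ 3 * cbrtThree) by field_simp, cbrtThree_pow]
      ring
    have k4 := k3 (Ai (sc t) *
      intFromInfty (fun s => Bi (sc s) * source u φ s) t - Bi (sc t) *
      intFromInfty (fun s => Ai (sc s) * source u φ s) t)
    rw [e1]
    rw [e1] at hS
    -- The terms from differentiating the integrals combine to `π(Ai Bi' - Ai' Bi) S = S` by the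
    -- Wronskian; the remaining ones give `-(t/6) φ₁` by the Airy equation.
    linear_combination -hS - (3 / 2) * k4 - Real.pi * source u φ t * hW - source u φ t * hpi
  · exact (d0.const_add (delta k)).congr (fun s hs => (h.2 s hs).2.2) (h.2 t ht).2.2

theorem intFromInfty_zero (t : ℝ) : intFromInfty (fun _ => 0) t = 0 := by simp [intFromInfty]

/-- The same linear relation holds between the sources and between the integrands for `φ₀`, so every
integral term drops out. At `T` this leaves `c₀ = 0` and the vanishing of `c₁ Bi + c₂ Ai` and of `c₁
Bi' + c₂ Ai'` at one point, which the nonzero Wronskian excludes unless `c₁ = c₂ = 0`. -/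
theorem eq_zero_of_linear_relation {Φ : Fin 3 → Fin 3 → ℝ → ℝ}
    (h : ∀ k, SolvesIntegralEquations u T k (Φ k)) (c : Fin 3 → ℝ)
    (hrel : ∀ (i : Fin 3) (t : ℝ), T ≤ t → ∑ k, c k * Φ k i t = 0) : c = 0 := by
  have hS : ∀ s, T ≤ s → c 0 * source u (Φ 0) s + c 1 * source u (Φ 1) s +
      c 2 * source u (Φ 2) s = 0 := by
    intro s hs
    have h0 := hrel 0 s hs
    have h1 := hrel 1 s hs
    simp only [Fin.sum_univ_three] at h0 h1
    simp only [source]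
    linear_combination -(2 / 3) * u s * h0 - 1 / 3 * u s ^ 2 * h1
  have comb : ∀ f : Fin 3 → ℝ → ℝ, (∀ k, IntegrableOn (f k) (Ioi T)) →
      (∀ s, T ≤ s → c 0 * f 0 s + c 1 * f 1 s + c 2 * f 2 s = 0) →
      c 0 * intFromInfty (f 0) T + c 1 * intFromInfty (f 1) T + c 2 * intFromInfty (f 2) T = 0 := by
    intro f hf h0
    have hi := fun k => (hf k).const_mul (c k)
    rw [← intFromInfty_const_mul, ← intFromInfty_const_mul, ← intFromInfty_const_mul,
      ← intFromInfty_add (hi 0) (hi 1) le_rfl,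
      ← intFromInfty_add
        (f := fun s => c 0 * f 0 s + c 1 * f 1 s) ((hi 0).add (hi 1)) (hi 2) le_rfl,
      intFromInfty_congr h0, intFromInfty_zero]
  have hA := comb (fun k s => Ai (sc s) * source u (Φ k) s) (fun k => (h k).1.2.1)
    fun s hs => by linear_combination Ai (sc s) * hS s hs
  have hB := comb (fun k s => Bi (sc s) * source u (Φ k) s) (fun k => (h k).1.1)
    fun s hs => by linear_combination Bi (sc s) * hS s hs
  have hZ := comb (fun k s => 1 / 3 * deriv u s * Φ k 1 s - 2 / 3 * u s * Φ k 2 s)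
    (fun k => (h k).1.2.2) fun s hs => by
      have h1 := hrel 1 s hs
      have h2 := hrel 2 s hs
      simp only [Fin.sum_univ_three] at h1 h2
      linear_combination 1 / 3 * deriv u s * h1 - 2 / 3 * u s * h2
  have r0 := hrel 0 T le_rfl
  have r1 := hrel 1 T le_rfl
  have r2 := hrel 2 T le_rfl
  simp only [Fin.sum_univ_three] at r0 r1 r2
  rw [((h 0).2 T le_rfl).2.2, ((h 1).2 T le_rfl).2.2, ((h 2).2 T le_rfl).2.2] at r0
  rw [((h 0).2 T le_rfl).1, ((h 1).2 T le_rfl).1, ((h 2).2 T le_rfl).1] at r1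
  rw [((h 0).2 T le_rfl).2.1, ((h 1).2 T le_rfl).2.1, ((h 2).2 T le_rfl).2.1] at r2
  simp only [rhsZero, rhsOne, rhsTwo] at r0 r1 r2
  have d0 : delta 0 = 1 := by simp [delta]
  have d1 : delta 1 = 0 := by simp [delta]
  have d2 : delta 2 = 0 := by simp [delta]
  rw [d0, d1, d2] at r0
  have c0 : c 0 = 0 := by linear_combination r0 - hZ
  have g0 : g 0 T = 0 := rfl
  have g1 : g 1 T = Bi (sc T) := rfl
  have g2 : g 2 T = Ai (sc T) := rfl
  rw [g0, g1, g2] at r1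
  rw [(hasDerivAt_g_zero T).deriv, (hasDerivAt_g_one T).deriv, (hasDerivAt_g_two T).deriv] at r2
  have q1 : c 1 * Bi (sc T) + c 2 * Ai (sc T) = 0 := by
    linear_combination r1 - 2 * Real.pi / (3 : ℝ) ^ (1 / 3 : ℝ) *
      (Ai (sc T) * hB - Bi (sc T) * hA)
  have q2 : (c 1 * deriv Bi (sc T) + c 2 * deriv Ai (sc T)) * (1 / cbrtThree ^ 2) = 0 := by
    linear_combination -(2 / 3) * (r2 + Real.pi * (deriv Ai (sc T) * hB - deriv Bi (sc T) * hA))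
  have q2' : c 1 * deriv Bi (sc T) + c 2 * deriv Ai (sc T) = 0 := by
    have := cbrtThree_pos
    exact (mul_eq_zero.1 q2).resolve_right (by positivity)
  have hW := wronskian (sc T)
  have hpi : Real.pi⁻¹ ≠ 0 := inv_ne_zero Real.pi_pos.ne'
  have c1 : c 1 = 0 := by
    have : c 1 * Real.pi⁻¹ = 0 := by
      rw [← hW]; linear_combination Ai (sc T) * q2' - deriv Ai (sc T) * q1
    exact (mul_eq_zero.1 this).resolve_right hpi
  have c2 : c 2 = 0 := by
    have : c 2 * Real.pi⁻¹ = 0 := by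
      rw [← hW]; linear_combination deriv Bi (sc T) * q1 - Bi (sc T) * q2'
    exact (mul_eq_zero.1 this).resolve_right hpi
  funext k
  fin_cases k
  exacts [c0, c1, c2]

end Solution

end AiryPicard

theorem mainTheorem4 (u : ℝ → ℝ) (hu : IsHastingsMcLeod u) :
    (∃ T : ℝ, IsThreshold u T) ∧
    ∀ T : ℝ, IsThreshold u T →
      (∀ (k : Fin 3) (j : ℕ), IntegralsConverge u T (AiryPicard.iterate u k j)) ∧
      (∀ (k : Fin 3) (j : ℕ) (t : ℝ), T ≤ t → DifferenceBounds u k j t) ∧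
      ∃ Φ : Fin 3 → Fin 3 → ℝ → ℝ,
        (∀ (k i : Fin 3) (t : ℝ), T ≤ t →
          Tendsto (fun j : ℕ => AiryPicard.iterate u k j i t) atTop (𝓝 (Φ k i t))) ∧
        (∀ k : Fin 3, SolvesIntegralEquations u T k (Φ k)) ∧
        (∀ k : Fin 3, IsSolutionOn u T (Φ k)) ∧
        (∀ c : Fin 3 → ℝ,
          (∀ (i : Fin 3) (t : ℝ), T ≤ t → ∑ k, c k * Φ k i t = 0) → c = 0) := by
  refine ⟨exists_threshold hu, fun T h => ⟨fun k j => ?_, fun k j t ht => ?_,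
    picardLimit u, fun k => ?_, fun k => ?_, fun k => ?_, ?_⟩⟩
  · obtain ⟨K, hK, -⟩ := exists_tame_iterate hu h k
    exact (hK j).integralsConverge hu h
  · exact differenceBounds hu h k j ht
  · obtain ⟨K, -, hlim⟩ := exists_tame_iterate hu h k
    exact hlim
  · exact solvesIntegralEquations hu h k
  · exact (solvesIntegralEquations hu h k).isSolutionOn hu
  · exact eq_zero_of_linear_relation fun k => solvesIntegralEquations hu h k
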